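/- Let \(X\) be a finite set and let \((\mathbb P_x)_{x\in X}\) be an irreducible Markov process \((x_t)_{t\ge 0}\) on \(X\), right-continuous, with almost surely finite lifetime \(\zeta\) (it sits in a cemetery state from time \(\zeta\) on) and generator \(L\), which need not be symmetric: \(\mathbb P_x(x_t=y)=(e^{tL})_{xy}\). Let \(V=(-L)^{-1}\) be its potential, let \(\mu\) be a probability on \(X\), and let \(m=\mu V\). For \(u\in X\) put \(l_t^u=\int_0^{t\wedge\zeta}1_{\{x_s=u\}}\frac{ds}{m_u}\) and \(l^u=l^u_\zeta\). For \(x,y\in X\) let \(\mathbb E_{x,y}\) be the (unnormalized) path measure defined by \[ \mathbb E_{x,y}(G)=\mathbb E_x\Big(\int_0^\zeta G(x_s,\,s\le t)\,dl_t^y\Big), \] so that under \(\mathbb E_{x,y}\) the path ends at the time \(t\), and \(l=(l^u)_{u\in X}\) is the local time field of the path so ended. For \(z\in\mathbb C^X\) write \(\langle Lz,\bar z\rangle_m=\sum_{u}(Lz)_u\,\bar z_u\,m_u\), let \(\tfrac12 z\bar z\) denote the point \((\tfrac12 z_u\bar z_u)_{u\in X}\) of \(\mathbb R_+^X\), and let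 \(\prod_u da_u\,db_u\), with \(z_u=a_u+ib_u\), be Lebesgue measure on \(\mathbb C^X\). Let \(F:\mathbb R_+^X\to\mathbb C\) be continuous. Then, whenever the two integrals below converge absolutely (the right-hand one as an integral over \(z\) and the path jointly), \[ (\ast)\qquad \int_{\mathbb C^X}\tfrac12\, z_x\bar z_y\,F\big(\tfrac12 z\bar z\big)\,e^{\frac12\langle Lz,\bar z\rangle_m}\prod_u da_u\,db_u =\int_{\mathbb C^X}\mathbb E_{x,y}\Big(F\big(l+\tfrac12 z\bar z\big)\Big)\,e^{\frac12\langle Lz,\bar z\rangle_m}\prod_u da_u\,db_u . \] Both integrals do converge absolutely when \(F\) has at most polynomial growth, i.e. when \(|F(\rho)|\le C\,(1+\sum_u\rho_u)^k\) on \(\mathbb R_+^X\) for some constants \(C,k\); in particular they do when \(F\) is bounded. -/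

import Mathlib

open MeasureTheory
open scoped NNReal ENNReal

/-- Lebesgue measure `dt` on the time axis `[0, ∞)`. -/
noncomputable def timeMeasure : Measure ℝ≥0 :=
  Measure.map Real.toNNReal ((volume : Measure ℝ).restrict (Set.Ici 0))

/-- Trajectories in `X` with a lifetime: functions of the time `t ≥ 0` with values in
`X ∪ {cemetery}` (the cemetery is `none`), right-continuous for the discrete topology and
absorbed at the cemetery. -/
structure KilledPath (X : Type*) where
  toFun : ℝ≥0 → Option X
  right_cont : ∀ t, ∃ t' > t, ∀ s, t ≤ s → s < t' → toFun s = toFun t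
  absorbed : ∀ s t, s ≤ t → toFun s = none → toFun t = none

namespace KilledPath

variable {X : Type*}

instance : CoeFun (KilledPath X) (fun _ => ℝ≥0 → Option X) := ⟨toFun⟩

/-- The sigma-algebra generated by the coordinates `w ↦ w t`. -/
instance : MeasurableSpace (KilledPath X) :=
  ⨆ t : ℝ≥0, MeasurableSpace.comap (fun w : KilledPath X => w t) ⊤

open scoped Classical in
/-- The path `w` observed up to time `t` and sent to the cemetery at time `t`. -/
noncomputable def killAt (w : KilledPath X) (t : ℝ≥0) : KilledPath X where
  toFun s := if s < t then w s else none
  right_cont := by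
    intro s
    by_cases hs : s < t
    · obtain ⟨s', hs', h⟩ := w.right_cont s
      refine ⟨min s' t, lt_min hs' hs, fun r hr hr' => ?_⟩
      rw [if_pos hs, if_pos (lt_of_lt_of_le hr' (min_le_right _ _))]
      exact h r hr (lt_of_lt_of_le hr' (min_le_left _ _))
    · refine ⟨s + 1, lt_add_one s, fun r hr _ => ?_⟩
      rw [if_neg hs, if_neg (fun h => hs (lt_of_le_of_lt hr h))]
  absorbed := by
    intro s r hsr h
    by_cases hr : r < t
    · rw [if_pos (lt_of_le_of_lt hsr hr)] at h
      rw [if_pos hr]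
      exact w.absorbed s r hsr h
    · rw [if_neg hr]

open scoped Classical in
/-- The total local time `l^u = ∫_0^ζ 1_{x_s = u} / m_u ds` of a path at the point `u`, with
respect to the reference measure `m`. On the event `x_s = u` one has `s < ζ`, so the upper
limit `ζ` need not be written. The local time `l_t^u` up to time `t` is the total local time
of the path killed at time `t`. -/
noncomputable def localTime (m : X → ℝ) (w : KilledPath X) (u : X) : ℝ :=
  ∫ s : ℝ≥0, (if w s = some u then (m u)⁻¹ else 0) ∂timeMeasure

end KilledPath

section FiniteChain

variable {X : Type*} [Fintype X] [DecidableEq X]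

/-- `P` is the family of laws `(P_x)`, `x ∈ X`, of the Markov process on the finite set `X`,
possibly with a finite lifetime, with generator `L`: under `P_x` the process starts at `x`,
and its finite-dimensional distributions are given by the transition semigroup `e^{tL}`. -/
structure IsMarkovFamily (L : Matrix X X ℝ) (P : X → Measure (KilledPath X)) : Prop where
  isProbabilityMeasure : ∀ x, IsProbabilityMeasure (P x)
  finiteDimensional : ∀ (n : ℕ) (t : ℕ → ℝ≥0) (y : ℕ → X), Monotone t → t 0 = 0 →
    (P (y 0)).real {w | ∀ i ≤ n, w (t i) = some (y i)} =
      ∏ i ∈ Finset.range n,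
        (NormedSpace.exp (((t (i + 1) : ℝ) - (t i : ℝ)) • L)) (y i) (y (i + 1))

/-- Every state is reached from every state with positive probability. -/
def IsIrreducibleFamily (P : X → Measure (KilledPath X)) : Prop :=
  ∀ x y, ∃ t : ℝ≥0, 0 < P x {w | w t = some y}

/-- The lifetime is almost surely finite, from every starting point. -/
def HasFiniteLifetime (P : X → Measure (KilledPath X)) : Prop :=
  ∀ x, ∀ᵐ w ∂(P x), ∃ t : ℝ≥0, w t = none

/-- The potential `V = (-L)⁻¹`. -/
noncomputable def potential (L : Matrix X X ℝ) : Matrix X X ℝ := (-L)⁻¹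

/-- The reference measure `m = μ V`. -/
noncomputable def refMeasure (L : Matrix X X ℝ) (μ : X → ℝ) : X → ℝ :=
  Matrix.vecMul μ (potential L)

/-- `⟨Lz, z̄⟩_m = ∑_u (Lz)_u z̄_u m_u`, for `z ∈ ℂ^X`. -/
noncomputable def energyForm (L : Matrix X X ℝ) (m : X → ℝ) (z : X → ℂ) : ℂ :=
  ∑ u, (∑ v, (L u v : ℂ) * z v) * (starRingEnd ℂ) (z u) * (m u : ℂ)

/-- The twisted Gaussian weight `exp (½ ⟨Lz, z̄⟩_m)`. -/
noncomputable def twistedWeight (L : Matrix X X ℝ) (m : X → ℝ) (z : X → ℂ) : ℂ :=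
  Complex.exp ((1 / 2 : ℂ) * energyForm L m z)

/-- The field `½ z_u z̄_u`, `u ∈ X`. -/
noncomputable def halfSquare (z : X → ℂ) (u : X) : ℝ := ‖z u‖ ^ 2 / 2

/-- The (unnormalized) path measure `E_{x,y}`, defined by
`E_{x,y}(G) = E_x (∫_0^ζ G(x_s, s ≤ t) dl_t^y)`, where `dl_t^y = 1_{x_t = y} / m_y dt`.
It is the image of `1_{x_t = y} / m_y P_x(dw) dt` under `(w, t) ↦ w` killed at time `t`. -/
noncomputable def pathMeasure (P : X → Measure (KilledPath X)) (m : X → ℝ) (x y : X) :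
    Measure (KilledPath X) :=
  Measure.map (fun p : KilledPath X × ℝ≥0 => p.1.killAt p.2)
    (ENNReal.ofReal (m y)⁻¹ •
      ((P x).prod timeMeasure).restrict {p | p.1 p.2 = some y})

/-- The integrand `½ z_x z̄_y F(½ z z̄) exp (½ ⟨Lz, z̄⟩_m)`. -/
noncomputable def gaussianSide (L : Matrix X X ℝ) (m : X → ℝ) (F : (X → ℝ) → ℂ) (x y : X)
    (z : X → ℂ) : ℂ :=
  (1 / 2 : ℂ) * (z x * (starRingEnd ℂ) (z y)) * F (halfSquare z) * twistedWeight L m z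

/-- The integrand `F(l + ½ z z̄) exp (½ ⟨Lz, z̄⟩_m)`, as a function of `z` and of the path. -/
noncomputable def localTimeSide (L : Matrix X X ℝ) (m : X → ℝ) (F : (X → ℝ) → ℂ)
    (p : (X → ℂ) × KilledPath X) : ℂ :=
  F (p.2.localTime m + halfSquare p.1) * twistedWeight L m p.1

end FiniteChain

open Filter Topology

/-! Both sides integrate `F` against the image of a complex density: on the left the field
`halfSquare z` with density `½ z_x z̄_y` times the twisted weight, on the right the sum of the local
times and `halfSquare z` with the twisted weight alone. Both densities are integrable, so the two
image measures are finite and coincide as soon as their Fourier transforms do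
(`integral_comp_mul_eq_of_fourier_eq`). After that `F` only has to be measurable and integrable
against both densities.

Multiplying by the character `exp (i ⟨ξ, ·⟩)` has the same effect on both sides: it replaces `L` by
`L_ξ = L + diag (i ξ/m)`, the `twistedGenerator`. On the Gaussian side, integration by parts
(`neg_sum_mul_integral_eq`) shows that the covariance is `Z (-L_ξ)⁻¹ diag (1/m)`, where `Z` is the
total integral of the weight built from `L_ξ`. On the path side, the character of `l + ½ z z̄`
factorizes. The Gaussian factor is the same `Z`, which is therefore never computed. The path factor
is `∫ (e^{t L_ξ})_{xy} dt / m_y` by the Feynman–Kac formula (`IsMarkovFamily.feynmanKac`), that is,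
the `(x, y)` entry of `(-L_ξ)⁻¹ diag (1/m)`. The imaginary potential keeps `e^{t L_ξ}` dominated
entrywise by `e^{tL}`, so these integrals converge. `IsMarkovFamily.integral_fourier_eq` puts the
two computations together.

Absolute convergence rests on two decay facts. The real part of the energy form is negative
definite, although `L` is not symmetric, because `m` is excessive: `mL = -μ ≤ 0`
(`IsMarkovFamily.re_energyForm_neg`). The semigroup decays exponentially because the lifetime is
finite (`Matrix.exists_abs_exp_smul_le`). -/

/-! ### Complex densities and Fourier uniqueness -/

theorem integral_map_withDensity_posPart {X : Type*} [Fintype X]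
    {Ω : Type*} [MeasurableSpace Ω] (ν : Measure Ω) (T : Ω → X → ℝ) (g : Ω → ℝ)
    (hT : Measurable T) (hm : Measurable g) (H : (X → ℝ) → ℂ) (hH : Measurable H)
    (hi : Integrable (fun a => H (T a) * g a) ν) :
    Integrable H ((ν.withDensity fun a => ENNReal.ofReal (g a)).map T) ∧
      ∫ r, H r ∂((ν.withDensity fun a => ENNReal.ofReal (g a)).map T) =
        ∫ a, H (T a) * ((max (g a) 0 : ℝ) : ℂ) ∂ν ∧
      Integrable (fun a => H (T a) * ((max (g a) 0 : ℝ) : ℂ)) ν := by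
  have hd : (fun a => ENNReal.ofReal (g a)) = fun a => ((g a).toNNReal : ℝ≥0∞) := rfl
  have hmm : Measurable fun a => (g a).toNNReal := hm.real_toNNReal
  have hI : Integrable (fun a => H (T a) * ((max (g a) 0 : ℝ) : ℂ)) ν := by
    refine hi.mono (by fun_prop) (ae_of_all _ fun a => ?_)
    rw [norm_mul, norm_mul]
    gcongr
    rw [Complex.norm_real, Complex.norm_real, Real.norm_eq_abs, Real.norm_eq_abs,
      abs_of_nonneg (le_max_right _ _)]
    exact max_le (le_abs_self _) (abs_nonneg _)
  refine ⟨?_, ?_, hI⟩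
  · rw [integrable_map_measure hH.aestronglyMeasurable hT.aemeasurable, hd,
      integrable_withDensity_iff_integrable_smul hmm]
    refine hI.congr (ae_of_all _ fun a => ?_)
    simp [NNReal.smul_def, mul_comm]
  · rw [integral_map hT.aemeasurable hH.aestronglyMeasurable, hd,
      integral_withDensity_eq_integral_smul hmm]
    refine integral_congr_ae (ae_of_all _ fun a => ?_)
    simp [NNReal.smul_def, mul_comm]

/-- Uniqueness of characteristic functions concerns positive measures, so a signed density is split
into positive and negative parts, each pushed forward separately. -/
theorem integral_comp_mul_eq_sub_map_withDensity {X : Type*} [Fintype X]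
    {Ω : Type*} [MeasurableSpace Ω] (ν : Measure Ω) (T : Ω → X → ℝ) (g : Ω → ℝ)
    (hT : Measurable T) (hm : Measurable g) (H : (X → ℝ) → ℂ) (hH : Measurable H)
    (hi : Integrable (fun a => H (T a) * g a) ν) :
    Integrable H ((ν.withDensity fun a => ENNReal.ofReal (g a)).map T) ∧
    Integrable H ((ν.withDensity fun a => ENNReal.ofReal (-g a)).map T) ∧
      ∫ a, H (T a) * g a ∂ν =
      ∫ r, H r ∂((ν.withDensity fun a => ENNReal.ofReal (g a)).map T) -
      ∫ r, H r ∂((ν.withDensity fun a => ENNReal.ofReal (-g a)).map T) := by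
  obtain ⟨h1, h2, h3⟩ := integral_map_withDensity_posPart ν T g hT hm H hH hi
  obtain ⟨h4, h5, h6⟩ := integral_map_withDensity_posPart ν T (fun a => -g a) hT hm.neg
    H hH (by simpa using hi.neg)
  refine ⟨h1, h4, ?_⟩
  rw [h2, h5, ← integral_sub h3 h6]
  refine integral_congr_ae (ae_of_all _ fun a => ?_)
  simp only [← mul_sub, ← Complex.ofReal_sub]
  congr 2
  rcases le_total 0 (g a) with hh | hh
  · rw [max_eq_left hh, max_eq_right (by linarith)]; ring
  · rw [max_eq_right hh, max_eq_left (by linarith)]; ring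

theorem isFiniteMeasure_map_withDensity_ofReal {X : Type*} {Ω : Type*} [MeasurableSpace Ω]
    (ν : Measure Ω) (T : Ω → X → ℝ) (g : Ω → ℝ) (hi : Integrable g ν) :
    IsFiniteMeasure ((ν.withDensity fun a => ENNReal.ofReal (g a)).map T) := by
  have := isFiniteMeasure_withDensity_ofReal hi.2
  infer_instance

theorem integral_comp_mul_eq_re_add_im {X : Type*} [Fintype X]
    {Ω : Type*} [MeasurableSpace Ω] (ν : Measure Ω) (T : Ω → X → ℝ) (g : Ω → ℂ)
    (G : (X → ℝ) → ℂ) (hT : Measurable T) (hm : Measurable g) (hG : Measurable G)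
    (hi : Integrable (fun a => G (T a) * g a) ν) :
    Integrable (fun a => G (T a) * (g a).re) ν ∧ Integrable (fun a => G (T a) * (g a).im) ν ∧
    ∫ a, G (T a) * g a ∂ν = ∫ a, G (T a) * (g a).re ∂ν +
      Complex.I * ∫ a, G (T a) * (g a).im ∂ν := by
  have h1 : Integrable (fun a => G (T a) * (g a).re) ν := by
    refine hi.mono (by fun_prop) (ae_of_all _ fun a => ?_)
    rw [norm_mul, norm_mul, Complex.norm_real]
    gcongr
    exact Complex.abs_re_le_norm _
  have h2 : Integrable (fun a => G (T a) * (g a).im) ν := by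
    refine hi.mono (by fun_prop) (ae_of_all _ fun a => ?_)
    rw [norm_mul, norm_mul, Complex.norm_real]
    gcongr
    exact Complex.abs_im_le_norm _
  refine ⟨h1, h2, ?_⟩
  rw [← integral_const_mul, ← integral_add h1 (h2.const_mul _)]
  refine integral_congr_ae (ae_of_all _ fun a => ?_)
  simp only
  conv_lhs => rw [← Complex.re_add_im (g a)]
  ring

theorem integrable_cexp_ofReal_mul_I_mul {Ω : Type*} [MeasurableSpace Ω] {ν : Measure Ω}
    {p : Ω → ℝ} (hp : Measurable p) {g : Ω → ℂ} (hg : Integrable g ν) :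
    Integrable (fun a => Complex.exp ((p a : ℂ) * Complex.I) * g a) ν := by
  refine hg.mono (AEStronglyMeasurable.mul (by fun_prop) hg.1) (ae_of_all _ fun a => ?_)
  rw [norm_mul, Complex.norm_exp_ofReal_mul_I, one_mul]

theorem integral_cexp_neg_mul_ofReal {Ω : Type*} [MeasurableSpace Ω] (ν : Measure Ω)
    (p g : Ω → ℝ) :
    ∫ a, Complex.exp (((-p a : ℝ) : ℂ) * Complex.I) * g a ∂ν =
      (starRingEnd ℂ) (∫ a, Complex.exp ((p a : ℂ) * Complex.I) * g a ∂ν) := by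
  rw [← integral_conj]
  simp [← Complex.exp_conj]

/-- A complex-valued density is determined, after pushing forward, by its Fourier transform:
the real-valued case. -/
theorem integral_comp_mul_ofReal_eq_of_fourier_eq {X : Type*} [Fintype X]
    {Ω₁ Ω₂ : Type*} [MeasurableSpace Ω₁] [MeasurableSpace Ω₂]
    {ν₁ : Measure Ω₁} {ν₂ : Measure Ω₂} {T₁ : Ω₁ → X → ℝ} {T₂ : Ω₂ → X → ℝ}
    (hT₁ : Measurable T₁) (hT₂ : Measurable T₂) {g₁ : Ω₁ → ℝ} {g₂ : Ω₂ → ℝ}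
    (hm₁ : Measurable g₁) (hm₂ : Measurable g₂)
    (hg₁ : Integrable g₁ ν₁) (hg₂ : Integrable g₂ ν₂)
    (h : ∀ ξ : X → ℝ, ∫ a, Complex.exp (((∑ u, ξ u * T₁ a u : ℝ) : ℂ) * Complex.I) * g₁ a ∂ν₁ =
      ∫ a, Complex.exp (((∑ u, ξ u * T₂ a u : ℝ) : ℂ) * Complex.I) * g₂ a ∂ν₂)
    {F : (X → ℝ) → ℂ} (hF : Measurable F)
    (hF₁ : Integrable (fun a => F (T₁ a) * g₁ a) ν₁)
    (hF₂ : Integrable (fun a => F (T₂ a) * g₂ a) ν₂) :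
    ∫ a, F (T₁ a) * g₁ a ∂ν₁ = ∫ a, F (T₂ a) * g₂ a ∂ν₂ := by
  classical
  have := isFiniteMeasure_map_withDensity_ofReal ν₁ T₁ g₁ hg₁
  have := isFiniteMeasure_map_withDensity_ofReal ν₁ T₁ (fun a => - g₁ a) hg₁.neg
  have := isFiniteMeasure_map_withDensity_ofReal ν₂ T₂ g₂ hg₂
  have := isFiniteMeasure_map_withDensity_ofReal ν₂ T₂ (fun a => - g₂ a) hg₂.neg
  -- Equality of the two signed images, with the negative parts moved across so that both sides are
  -- positive finite measures.
  have hmeas : (ν₁.withDensity fun a => ENNReal.ofReal (g₁ a)).map T₁ +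
      (ν₂.withDensity fun a => ENNReal.ofReal (-g₂ a)).map T₂ =
      (ν₂.withDensity fun a => ENNReal.ofReal (g₂ a)).map T₂ +
      (ν₁.withDensity fun a => ENNReal.ofReal (-g₁ a)).map T₁ := by
    refine Measure.ext_of_charFunDual (funext fun l => ?_)
    set ξ : X → ℝ := fun u => l (Pi.single u 1) with hξ
    have hl : ∀ r : X → ℝ, l r = ∑ u, ξ u * r u := by
      intro r
      conv_lhs => rw [← Finset.univ_sum_single r, map_sum]
      refine Finset.sum_congr rfl fun u _ => ?_
      have : (Pi.single u (r u) : X → ℝ) = r u • Pi.single u 1 := by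
        rw [← Pi.single_smul, smul_eq_mul, mul_one]
      rw [this, map_smul, smul_eq_mul, mul_comm]
    set H : (X → ℝ) → ℂ := fun r => Complex.exp (((∑ u, ξ u * r u : ℝ) : ℂ) * Complex.I) with hH
    have hHm : Measurable H := by
      have : Continuous H := by fun_prop
      exact this.measurable
    obtain ⟨a1, a2, a3⟩ := integral_comp_mul_eq_sub_map_withDensity ν₁ T₁ g₁ hT₁ hm₁ H hHm
      (integrable_cexp_ofReal_mul_I_mul (by fun_prop) hg₁.ofReal)
    obtain ⟨b1, b2, b3⟩ := integral_comp_mul_eq_sub_map_withDensity ν₂ T₂ g₂ hT₂ hm₂ H hHm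
      (integrable_cexp_ofReal_mul_I_mul (by fun_prop) hg₂.ofReal)
    have := h ξ
    change ∫ a, H (T₁ a) * g₁ a ∂ν₁ = ∫ a, H (T₂ a) * g₂ a ∂ν₂ at this
    rw [a3, b3] at this
    simp only [charFunDual_apply, hl]
    change ∫ r, H r ∂_ = ∫ r, H r ∂_
    rw [integral_add_measure a1 b2, integral_add_measure b1 a2]
    linear_combination this
  obtain ⟨a1, a2, a3⟩ := integral_comp_mul_eq_sub_map_withDensity ν₁ T₁ g₁ hT₁ hm₁ F hF hF₁
  obtain ⟨b1, b2, b3⟩ := integral_comp_mul_eq_sub_map_withDensity ν₂ T₂ g₂ hT₂ hm₂ F hF hF₂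
  rw [a3, b3]
  have := congrArg (fun ν => ∫ r, F r ∂ν) hmeas
  rw [integral_add_measure a1 b2, integral_add_measure b1 a2] at this
  linear_combination this

/-- If the pushforwards of two complex densities have the same Fourier transform, then they
integrate every function in the same way. -/
theorem integral_comp_mul_eq_of_fourier_eq {X : Type*} [Fintype X]
    {Ω₁ Ω₂ : Type*} [MeasurableSpace Ω₁] [MeasurableSpace Ω₂]
    {ν₁ : Measure Ω₁} {ν₂ : Measure Ω₂} {T₁ : Ω₁ → X → ℝ} {T₂ : Ω₂ → X → ℝ}
    (hT₁ : Measurable T₁) (hT₂ : Measurable T₂) {g₁ : Ω₁ → ℂ} {g₂ : Ω₂ → ℂ}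
    (hm₁ : Measurable g₁) (hm₂ : Measurable g₂)
    (hg₁ : Integrable g₁ ν₁) (hg₂ : Integrable g₂ ν₂)
    (h : ∀ ξ : X → ℝ, ∫ a, Complex.exp (((∑ u, ξ u * T₁ a u : ℝ) : ℂ) * Complex.I) * g₁ a ∂ν₁ =
      ∫ a, Complex.exp (((∑ u, ξ u * T₂ a u : ℝ) : ℂ) * Complex.I) * g₂ a ∂ν₂)
    {F : (X → ℝ) → ℂ} (hF : Measurable F)
    (hF₁ : Integrable (fun a => F (T₁ a) * g₁ a) ν₁)
    (hF₂ : Integrable (fun a => F (T₂ a) * g₂ a) ν₂) :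
    ∫ a, F (T₁ a) * g₁ a ∂ν₁ = ∫ a, F (T₂ a) * g₂ a ∂ν₂ := by
  set H : (X → ℝ) → (X → ℝ) → ℂ :=
    fun ξ r => Complex.exp (((∑ u, ξ u * r u : ℝ) : ℂ) * Complex.I) with hH
  have hHm : ∀ ξ, Measurable (H ξ) := by
    intro ξ
    have : Continuous (H ξ) := by fun_prop
    exact this.measurable
  have conj₁ : ∀ (ξ : X → ℝ) (g : Ω₁ → ℝ), ∫ a, H (-ξ) (T₁ a) * g a ∂ν₁ =
      (starRingEnd ℂ) (∫ a, H ξ (T₁ a) * g a ∂ν₁) := by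
    intro ξ g
    rw [← integral_cexp_neg_mul_ofReal]
    simp [hH]
  have conj₂ : ∀ (ξ : X → ℝ) (g : Ω₂ → ℝ), ∫ a, H (-ξ) (T₂ a) * g a ∂ν₂ =
      (starRingEnd ℂ) (∫ a, H ξ (T₂ a) * g a ∂ν₂) := by
    intro ξ g
    rw [← integral_cexp_neg_mul_ofReal]
    simp [hH]
  -- For a real density the transform at `-ξ` is the conjugate of the one at `ξ`. Comparing the
  -- hypothesis at `ξ` with the conjugate of the hypothesis at `-ξ` therefore separates the real and
  -- imaginary parts of the densities.
  have split : ∀ ξ, (∫ a, H ξ (T₁ a) * (g₁ a).re ∂ν₁ = ∫ a, H ξ (T₂ a) * (g₂ a).re ∂ν₂) ∧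
      (∫ a, H ξ (T₁ a) * (g₁ a).im ∂ν₁ = ∫ a, H ξ (T₂ a) * (g₂ a).im ∂ν₂) := by
    intro ξ
    obtain ⟨-, -, a⟩ := integral_comp_mul_eq_re_add_im ν₁ T₁ g₁ (H ξ) hT₁ hm₁ (hHm ξ)
      (integrable_cexp_ofReal_mul_I_mul (by fun_prop) hg₁)
    obtain ⟨-, -, b⟩ := integral_comp_mul_eq_re_add_im ν₂ T₂ g₂ (H ξ) hT₂ hm₂ (hHm ξ)
      (integrable_cexp_ofReal_mul_I_mul (by fun_prop) hg₂)
    obtain ⟨-, -, a'⟩ := integral_comp_mul_eq_re_add_im ν₁ T₁ g₁ (H (-ξ)) hT₁ hm₁ (hHm _)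
      (integrable_cexp_ofReal_mul_I_mul (by fun_prop) hg₁)
    obtain ⟨-, -, b'⟩ := integral_comp_mul_eq_re_add_im ν₂ T₂ g₂ (H (-ξ)) hT₂ hm₂ (hHm _)
      (integrable_cexp_ofReal_mul_I_mul (by fun_prop) hg₂)
    have e := h ξ
    change ∫ a, H ξ (T₁ a) * g₁ a ∂ν₁ = ∫ a, H ξ (T₂ a) * g₂ a ∂ν₂ at e
    have e' := h (-ξ)
    change ∫ a, H (-ξ) (T₁ a) * g₁ a ∂ν₁ = ∫ a, H (-ξ) (T₂ a) * g₂ a ∂ν₂ at e'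
    rw [a, b] at e
    rw [a', b', conj₁, conj₁, conj₂, conj₂] at e'
    have e'' := congrArg (starRingEnd ℂ) e'
    simp only [map_add, map_mul, Complex.conj_conj, Complex.conj_I] at e''
    constructor
    · linear_combination (e + e'') / 2
    · have : Complex.I * (∫ a, H ξ (T₁ a) * (g₁ a).im ∂ν₁) =
          Complex.I * (∫ a, H ξ (T₂ a) * (g₂ a).im ∂ν₂) := by
        linear_combination (e - e'') / 2
      exact mul_left_cancel₀ Complex.I_ne_zero this
  obtain ⟨a1, a2, a3⟩ := integral_comp_mul_eq_re_add_im ν₁ T₁ g₁ F hT₁ hm₁ hF hF₁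
  obtain ⟨b1, b2, b3⟩ := integral_comp_mul_eq_re_add_im ν₂ T₂ g₂ F hT₂ hm₂ hF hF₂
  rw [a3, b3, integral_comp_mul_ofReal_eq_of_fourier_eq (g₁ := fun a => (g₁ a).re)
      (g₂ := fun a => (g₂ a).re) hT₁ hT₂
      (Complex.measurable_re.comp hm₁) (Complex.measurable_re.comp hm₂) hg₁.re hg₂.re
      (fun ξ => (split ξ).1) hF a1 b1,
    integral_comp_mul_ofReal_eq_of_fourier_eq (g₁ := fun a => (g₁ a).im)
      (g₂ := fun a => (g₂ a).im) hT₁ hT₂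
      (Complex.measurable_im.comp hm₁) (Complex.measurable_im.comp hm₂) hg₁.im hg₂.im
      (fun ξ => (split ξ).2) hF a2 b2]

/-! ### The Lie–Trotter product formula -/

section Trotter

variable {𝔸 : Type*} [NormedRing 𝔸] [NormOneClass 𝔸]

theorem norm_normedSpace_exp_le [NormedAlgebra ℝ 𝔸] (a : 𝔸) :
    ‖NormedSpace.exp a‖ ≤ Real.exp ‖a‖ := by
  have hs : Summable fun n : ℕ => ((n.factorial : ℝ)⁻¹) * ‖a‖ ^ n := by
    simpa [div_eq_inv_mul] using Real.summable_pow_div_factorial ‖a‖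
  have hb : ∀ n : ℕ, ‖((n.factorial : ℝ)⁻¹) • a ^ n‖ ≤ ((n.factorial : ℝ)⁻¹) * ‖a‖ ^ n := by
    intro n
    rw [norm_smul, norm_inv, Real.norm_natCast]
    gcongr
    exact norm_pow_le a n
  rw [NormedSpace.exp_eq_tsum ℝ, Real.exp_eq_exp_ℝ, NormedSpace.exp_eq_tsum ℝ]
  simpa [smul_eq_mul] using tsum_of_norm_bounded hs.hasSum hb

/-- Telescoping. The exponent `n` in place of the sharp `n - 1` costs nothing when `1 ≤ R` and
avoids a natural subtraction. -/
theorem norm_pow_sub_pow_le_of_norm_le {a b : 𝔸} {R : ℝ} (hR : 1 ≤ R) (ha : ‖a‖ ≤ R)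
    (hb : ‖b‖ ≤ R) (n : ℕ) : ‖a ^ n - b ^ n‖ ≤ n * R ^ n * ‖a - b‖ := by
  induction n with
  | zero => simp
  | succ n ih =>
    have e : a ^ (n + 1) - b ^ (n + 1) = a ^ n * (a - b) + (a ^ n - b ^ n) * b := by
      rw [pow_succ, pow_succ]; noncomm_ring
    have h0 : (0 : ℝ) ≤ R := by linarith
    have h1 : ‖a ^ n‖ ≤ R ^ n := (norm_pow_le a n).trans (by gcongr)
    calc ‖a ^ (n + 1) - b ^ (n + 1)‖ ≤ ‖a ^ n‖ * ‖a - b‖ + ‖a ^ n - b ^ n‖ * ‖b‖ := by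
          rw [e]
          exact (norm_add_le _ _).trans (add_le_add (norm_mul_le _ _) (norm_mul_le _ _))
      _ ≤ R ^ n * R * ‖a - b‖ + (n * R ^ n * ‖a - b‖) * R := by
          gcongr
          exact h1.trans (le_mul_of_one_le_right (by positivity) hR)
      _ = ((n + 1 : ℕ) : ℝ) * R ^ (n + 1) * ‖a - b‖ := by push_cast; ring

/-- The **Lie–Trotter product formula** in a Banach algebra. -/
theorem tendsto_exp_mul_exp_pow [NormedAlgebra ℝ 𝔸] [CompleteSpace 𝔸] (a b : 𝔸) :
    Tendsto (fun n : ℕ => (NormedSpace.exp (((n : ℝ) + 1)⁻¹ • a) *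
      NormedSpace.exp (((n : ℝ) + 1)⁻¹ • b)) ^ (n + 1)) atTop (𝓝 (NormedSpace.exp (a + b))) := by
  let +nondep : NormedAlgebra ℚ 𝔸 := NormedAlgebra.restrictScalars ℚ ℝ 𝔸
  set f : ℝ → 𝔸 := fun h => NormedSpace.exp (h • a) * NormedSpace.exp (h • b) with hf
  set g : ℝ → 𝔸 := fun h => NormedSpace.exp (h • (a + b)) with hg
  -- The two one-step factors agree to first order at `0`, so their difference at step `h` is
  -- `o(h)`. The sum of the `n + 1` telescoped errors then tends to zero.
  have hd : HasDerivAt (fun h => f h - g h) 0 0 := by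
    have h1 := (hasDerivAt_exp_smul_const (𝕂 := ℝ) a (0 : ℝ)).mul
      (hasDerivAt_exp_smul_const (𝕂 := ℝ) b (0 : ℝ))
    have h2 := hasDerivAt_exp_smul_const (𝕂 := ℝ) (a + b) (0 : ℝ)
    have := h1.sub h2
    refine this.congr_deriv ?_
    simp [NormedSpace.exp_zero]
  have hslope := hasDerivAt_iff_tendsto_slope_zero.1 hd
  have hseq : Tendsto (fun n : ℕ => ((n : ℝ) + 1)⁻¹) atTop (𝓝[≠] 0) := by
    refine tendsto_nhdsWithin_iff.2 ⟨?_, Eventually.of_forall fun n => ?_⟩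
    · simpa [one_div] using tendsto_one_div_add_atTop_nhds_zero_nat (𝕜 := ℝ)
    · have : (0 : ℝ) < ((n : ℝ) + 1)⁻¹ := by positivity
      exact this.ne'
  have h0 : f 0 - g 0 = 0 := by simp [hf, hg, NormedSpace.exp_zero]
  have hlim := (hslope.comp hseq).norm
  simp only [Function.comp_def, zero_add, h0, sub_zero, inv_inv, norm_zero] at hlim
  rw [tendsto_iff_norm_sub_tendsto_zero]
  set M := ‖a‖ + ‖b‖ with hM
  have hlim2 := hlim.const_mul (Real.exp M)
  rw [mul_zero] at hlim2
  refine squeeze_zero (fun _ => norm_nonneg _) (fun n => ?_) hlim2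
  set h : ℝ := ((n : ℝ) + 1)⁻¹ with hh
  have hpos : 0 < h := by positivity
  have hgn : NormedSpace.exp (a + b) = g h ^ (n + 1) := by
    rw [hg, ← NormedSpace.exp_nsmul]
    congr 1
    rw [← Nat.cast_smul_eq_nsmul ℝ, smul_smul, hh]
    push_cast
    rw [mul_inv_cancel₀ (by positivity), one_smul]
  have hRf : ‖f h‖ ≤ Real.exp (h * M) := by
    refine (norm_mul_le _ _).trans ?_
    rw [hM, mul_add, Real.exp_add]
    gcongr
    · exact (norm_normedSpace_exp_le _).trans_eq (by rw [norm_smul, Real.norm_of_nonneg hpos.le])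
    · exact (norm_normedSpace_exp_le _).trans_eq (by rw [norm_smul, Real.norm_of_nonneg hpos.le])
  have hRg : ‖g h‖ ≤ Real.exp (h * M) := by
    refine (norm_normedSpace_exp_le _).trans ?_
    rw [norm_smul, Real.norm_of_nonneg hpos.le]
    gcongr
    exact norm_add_le _ _
  -- Since `(n + 1) h = 1`, the stability constant does not depend on `n`.
  have hRpow : Real.exp (h * M) ^ (n + 1) = Real.exp M := by
    rw [← Real.exp_nat_mul]
    congr 1
    push_cast
    rw [← mul_assoc, hh, mul_inv_cancel₀ (by positivity), one_mul]
  have := norm_pow_sub_pow_le_of_norm_le (Real.one_le_exp (by positivity)) hRf hRg (n + 1)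
  rw [hRpow] at this
  rw [hgn]
  refine this.trans_eq ?_
  rw [norm_smul, Real.norm_of_nonneg (by positivity)]
  push_cast
  ring

end Trotter

/-! ### Matrix semigroups: inversion of the generator and exponential decay -/

section MatrixExp

variable {X : Type*} [Fintype X] [DecidableEq X]

attribute [local instance] Matrix.linftyOpNormedRing Matrix.linftyOpNormedAlgebra

theorem Matrix.tendsto_exp_mul_exp_pow [Nonempty X] (A B : Matrix X X ℂ) :
    Tendsto (fun n : ℕ => (NormedSpace.exp (((n : ℝ) + 1)⁻¹ • A) *
      NormedSpace.exp (((n : ℝ) + 1)⁻¹ • B)) ^ (n + 1)) atTop (𝓝 (NormedSpace.exp (A + B))) :=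
  _root_.tendsto_exp_mul_exp_pow A B

theorem Matrix.exp_map_ofReal (A : Matrix X X ℝ) :
    NormedSpace.exp (A.map ((↑) : ℝ → ℂ)) = (NormedSpace.exp A).map ((↑) : ℝ → ℂ) := by
  let +nondep : NormedAlgebra ℚ (Matrix X X ℝ) := NormedAlgebra.restrictScalars ℚ ℝ _
  let +nondep : NormedAlgebra ℚ (Matrix X X ℂ) := NormedAlgebra.restrictScalars ℚ ℝ _
  have hc : Continuous (Complex.ofRealHom.mapMatrix : Matrix X X ℝ →+* Matrix X X ℂ) :=
    continuous_id.matrix_map Complex.continuous_ofReal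
  exact (NormedSpace.map_exp (Complex.ofRealHom.mapMatrix : Matrix X X ℝ →+* Matrix X X ℂ) hc
    A).symm

theorem Matrix.exp_add_smul {𝕜 : Type*} [RCLike 𝕜] (A : Matrix X X 𝕜) (s t : ℝ) :
    NormedSpace.exp ((s + t) • A) = NormedSpace.exp (s • A) * NormedSpace.exp (t • A) := by
  rw [add_smul, Matrix.exp_add_of_commute]
  exact ((Commute.refl A).smul_left s).smul_right t

theorem Matrix.hasDerivAt_exp_smul_apply {𝕜 : Type*} [RCLike 𝕜] (A : Matrix X X 𝕜) (i j : X)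
    (t : ℝ) : HasDerivAt (fun s : ℝ => NormedSpace.exp (s • A) i j)
      (∑ k, A i k * NormedSpace.exp (t • A) k j) t := by
  have h := hasDerivAt_exp_smul_const' (𝕂 := ℝ) A t
  have h' := hasDerivAt_pi.1 (hasDerivAt_pi.1 h i) j
  rwa [Matrix.mul_apply] at h'

theorem Matrix.continuous_exp_smul_apply {𝕜 : Type*} [RCLike 𝕜] (A : Matrix X X 𝕜) (i j : X) :
    Continuous fun s : ℝ => NormedSpace.exp (s • A) i j :=
  continuous_iff_continuousAt.2 fun t => (A.hasDerivAt_exp_smul_apply i j t).continuousAt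

/-- The Laplace transform at `0` of an integrable matrix semigroup inverts its generator. -/
theorem Matrix.neg_mul_integral_exp_smul {𝕜 : Type*} [RCLike 𝕜] (A : Matrix X X 𝕜)
    (h : ∀ i j, IntegrableOn (fun t : ℝ => NormedSpace.exp (t • A) i j) (Set.Ioi 0)) :
    (-A) * Matrix.of (fun i j => ∫ t in Set.Ioi (0 : ℝ), NormedSpace.exp (t • A) i j) = 1 := by
  ext i j
  have hint : IntegrableOn (fun t : ℝ => ∑ k, A i k * NormedSpace.exp (t • A) k j) (Set.Ioi 0) :=
    integrable_finsetSum _ fun k _ => (h k j).const_mul _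
  -- An integrable function with integrable derivative tends to zero, so the boundary term at
  -- infinity vanishes and only the identity at time `0` remains.
  have hlim := tendsto_zero_of_hasDerivAt_of_integrableOn_Ioi
    (fun t _ => A.hasDerivAt_exp_smul_apply i j t) hint (h i j)
  have hI := integral_Ioi_of_hasDerivAt_of_tendsto'
    (fun t _ => A.hasDerivAt_exp_smul_apply i j t) hint hlim
  rw [integral_finsetSum _ fun k _ => (h k j).const_mul _] at hI
  simp only [integral_const_mul, zero_smul, NormedSpace.exp_zero, zero_sub] at hI
  rw [Matrix.neg_mul, Matrix.neg_apply, Matrix.mul_apply]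
  simp only [Matrix.of_apply]
  rw [hI, neg_neg]

/-- One integer time `N` with norm below `e⁻¹` is enough: writing `t = kN + r` with `0 ≤ r ≤ N`,
submultiplicativity gives the rate `1/N`, and the remainder `r` costs a bounded factor. -/
theorem Matrix.exists_abs_exp_smul_le [Nonempty X] (A : Matrix X X ℝ)
    (h : ∀ i j, Tendsto (fun n : ℕ => NormedSpace.exp ((n : ℝ) • A) i j) atTop (𝓝 0)) :
    ∃ C c : ℝ, 0 < c ∧ ∀ t : ℝ, 0 ≤ t → ∀ i j,
      |NormedSpace.exp (t • A) i j| ≤ C * Real.exp (-c * t) := by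
  have hlim : Tendsto (fun n : ℕ => ‖NormedSpace.exp ((n : ℝ) • A)‖) atTop (𝓝 0) := by
    have : Tendsto (fun n : ℕ => NormedSpace.exp ((n : ℝ) • A)) atTop (𝓝 0) :=
      tendsto_pi_nhds.2 fun i => tendsto_pi_nhds.2 fun j => h i j
    simpa using this.norm
  obtain ⟨N, hN, hN1⟩ := ((hlim.eventually (gt_mem_nhds (show (0 : ℝ) < Real.exp (-1) by
    positivity))).and (eventually_ge_atTop 1)).exists
  have hNpos : (0 : ℝ) < N := by exact_mod_cast hN1
  have hentry : ∀ (B : Matrix X X ℝ) i j, |B i j| ≤ ‖B‖ := by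
    intro B i j
    rw [Matrix.linfty_opNorm_def]
    have h1 : ‖B i j‖₊ ≤ ∑ j, ‖B i j‖₊ :=
      Finset.single_le_sum (f := fun j => ‖B i j‖₊) (fun _ _ => zero_le) (Finset.mem_univ j)
    have h2 : ∑ j, ‖B i j‖₊ ≤ Finset.univ.sup fun i => ∑ j, ‖B i j‖₊ :=
      Finset.le_sup (f := fun i => ∑ j, ‖B i j‖₊) (Finset.mem_univ i)
    exact_mod_cast h1.trans h2
  refine ⟨Real.exp (N * ‖A‖) * Real.exp 1, (N : ℝ)⁻¹, by positivity, fun t ht i j => ?_⟩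
  refine (hentry _ i j).trans ?_
  set k := ⌊t / N⌋₊ with hk
  have hk1 : (k : ℝ) ≤ t / N := Nat.floor_le (by positivity)
  have hk2 : t / N < k + 1 := Nat.lt_floor_add_one _
  have hk1' : k * (N : ℝ) ≤ t := (le_div_iff₀ hNpos).1 hk1
  have hk2' : t - k * N ≤ N := by
    have := (div_lt_iff₀ hNpos).1 hk2
    linarith
  have e : t = k * (N : ℝ) + (t - k * N) := by ring
  have hpow : NormedSpace.exp ((k * (N : ℝ)) • A) = NormedSpace.exp ((N : ℝ) • A) ^ k := by
    rw [← Matrix.exp_nsmul, ← Nat.cast_smul_eq_nsmul ℝ, smul_smul]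
  conv_lhs => rw [e, Matrix.exp_add_smul, hpow]
  calc ‖NormedSpace.exp ((N : ℝ) • A) ^ k * NormedSpace.exp ((t - k * N) • A)‖
      ≤ Real.exp (-1) ^ k * Real.exp (N * ‖A‖) := by
        refine (norm_mul_le _ _).trans ?_
        gcongr
        · exact (norm_pow_le _ _).trans (by gcongr)
        · refine (norm_normedSpace_exp_le _).trans ?_
          rw [norm_smul, Real.norm_of_nonneg (by linarith)]
          gcongr
    _ = Real.exp (N * ‖A‖) * Real.exp (-k) := by
        rw [← Real.exp_nat_mul, mul_comm]; congr 2; ring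
    _ ≤ Real.exp (N * ‖A‖) * Real.exp (1 - t / N) := by gcongr; linarith
    _ = Real.exp (N * ‖A‖) * Real.exp 1 * Real.exp (-(N : ℝ)⁻¹ * t) := by
        rw [mul_assoc, ← Real.exp_add 1, div_eq_inv_mul, neg_mul, sub_eq_add_neg]

theorem Matrix.integrableOn_pow_mul_exp_smul [Nonempty X] (A : Matrix X X ℝ)
    (h : ∀ i j, Tendsto (fun n : ℕ => NormedSpace.exp ((n : ℝ) • A) i j) atTop (𝓝 0))
    (a : ℝ) (k : ℕ) (i j : X) :
    IntegrableOn (fun t : ℝ => (1 + a * t) ^ k * NormedSpace.exp (t • A) i j) (Set.Ioi 0) := by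
  obtain ⟨C, c, hc, hb⟩ := A.exists_abs_exp_smul_le h
  refine integrable_of_isBigO_exp_neg (b := c / 2) (by positivity)
    (Continuous.continuousOn ?_) ?_
  · have := A.continuous_exp_smul_apply i j
    fun_prop
  have h1 : (fun t : ℝ => (1 + a * t) ^ k) =O[atTop] fun t => Real.exp (c / 2 * t) := by
    have hl : (fun t : ℝ => 1 + a * t) =O[atTop] fun t => t := by
      refine Asymptotics.IsBigO.add ?_ (Asymptotics.isBigO_const_mul_self a _ _)
      exact (Asymptotics.isLittleO_const_id_atTop (1 : ℝ)).isBigO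
    exact (hl.pow k).trans (isLittleO_pow_exp_pos_mul_atTop k (by positivity)).isBigO
  have h2 : (fun t : ℝ => NormedSpace.exp (t • A) i j) =O[atTop] fun t => Real.exp (-c * t) := by
    refine Asymptotics.IsBigO.of_bound C ?_
    filter_upwards [eventually_ge_atTop 0] with t ht
    rw [Real.norm_eq_abs, Real.norm_of_nonneg (Real.exp_nonneg _)]
    exact hb t ht i j
  refine (h1.mul h2).congr_right fun t => ?_
  rw [← Real.exp_add]
  congr 1
  ring

end MatrixExp

/-! ### Path space: measurability, local times and Riemann sums -/

namespace KilledPath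

variable {X : Type*}

/-- The smallest multiple of `δ` that is at least `t`. -/
noncomputable def roundUp (δ t : ℝ≥0) : ℝ≥0 := ⌈t / δ⌉₊ * δ

theorem le_roundUp {δ : ℝ≥0} (hδ : 0 < δ) (t : ℝ≥0) : t ≤ roundUp δ t :=
  (div_le_iff₀ hδ).1 (Nat.le_ceil _)

theorem roundUp_le {δ : ℝ≥0} (hδ : 0 < δ) (t : ℝ≥0) : roundUp δ t ≤ t + δ := by
  have h := (Nat.ceil_lt_add_one (zero_le : 0 ≤ t / δ)).le
  calc roundUp δ t ≤ (t / δ + 1) * δ := by unfold roundUp; gcongr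
    _ = t + δ := by rw [add_mul, one_mul, div_mul_cancel₀ _ hδ.ne']

theorem roundUp_eq {δ : ℝ≥0} (hδ : 0 < δ) {i : ℕ} {t : ℝ≥0} (h1 : i * δ < t)
    (h2 : t ≤ (i + 1) * δ) : roundUp δ t = (i + 1) * δ := by
  have : ⌈t / δ⌉₊ = i + 1 := by
    rw [Nat.ceil_eq_iff (by simp)]
    push_cast
    exact ⟨by simpa using (lt_div_iff₀ hδ).2 h1, (div_le_iff₀ hδ).2 h2⟩
  rw [roundUp, this]
  push_cast
  rfl

@[fun_prop]
theorem measurable_roundUp (δ : ℝ≥0) : Measurable (roundUp δ) :=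
  ((measurable_from_nat (f := fun k : ℕ => (k : ℝ≥0))).comp
    (Nat.measurable_ceil.comp (measurable_id.div_const δ))).mul_const δ

/-- Rounding upwards approaches `t` from the right, where the path is locally constant. This is the
only form in which right-continuity enters the later limits. -/
theorem eventually_apply_roundUp (w : KilledPath X) {δ : ℕ → ℝ≥0} (hδ : ∀ n, 0 < δ n)
    (hlim : Tendsto δ atTop (𝓝 0)) (t : ℝ≥0) : ∀ᶠ n in atTop, w (roundUp (δ n) t) = w t := by
  obtain ⟨t', ht', h⟩ := w.right_cont t
  filter_upwards [hlim.eventually (gt_mem_nhds (tsub_pos_of_lt ht'))] with n hn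
  refine h _ (le_roundUp (hδ n) t) ((roundUp_le (hδ n) t).trans_lt ?_)
  rw [add_comm]
  exact lt_tsub_iff_right.1 hn

theorem measurable_comp_of_measurableSet_fiber [Finite X] {Y β : Type*} [MeasurableSpace Y]
    [MeasurableSpace β] {f : Y → Option X} (h : ∀ o, MeasurableSet {y | f y = o})
    (c : Option X → β) : Measurable fun y => c (f y) := by
  let : MeasurableSpace (Option X) := ⊤
  have hf : Measurable f := measurable_to_countable' h
  exact measurable_from_top.comp hf

theorem measurableSet_apply_eq (t : ℝ≥0) (o : Option X) :
    MeasurableSet {w : KilledPath X | w t = o} := by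
  have h : MeasurableSpace.comap (fun w : KilledPath X => w t) ⊤ ≤
      (inferInstance : MeasurableSpace (KilledPath X)) :=
    le_iSup (fun t : ℝ≥0 => MeasurableSpace.comap (fun w : KilledPath X => w t) ⊤) t
  exact h _ ⟨{o}, trivial, rfl⟩

theorem measurable_of_measurableSet_apply_eq [Finite X] {Y : Type*} [MeasurableSpace Y]
    {f : Y → KilledPath X} (h : ∀ t o, MeasurableSet {y | f y t = o}) : Measurable f := by
  rw [measurable_iff_comap_le]
  change MeasurableSpace.comap f
    (⨆ t : ℝ≥0, MeasurableSpace.comap (fun w : KilledPath X => w t) ⊤) ≤ _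
  rw [MeasurableSpace.comap_iSup]
  refine iSup_le fun t => ?_
  rw [MeasurableSpace.comap_comp, ← measurable_iff_comap_le]
  let : MeasurableSpace (Option X) := ⊤
  exact measurable_to_countable' (h t)

theorem measurableSet_prod_roundUp_eq (δ : ℝ≥0) (o : Option X) :
    MeasurableSet {p : KilledPath X × ℝ≥0 | p.1 (roundUp δ p.2) = o} := by
  have : {p : KilledPath X × ℝ≥0 | p.1 (roundUp δ p.2) = o} =
      ⋃ k : ℕ, {w : KilledPath X | w (k * δ) = o} ×ˢ {t : ℝ≥0 | ⌈t / δ⌉₊ = k} := by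
    ext p
    simp [roundUp]
  rw [this]
  refine MeasurableSet.iUnion fun k => (measurableSet_apply_eq _ _).prod ?_
  exact (Nat.measurable_ceil.comp (measurable_id.div_const δ)) (measurableSet_singleton k)

/-- Evaluation is jointly measurable in the path and in the time. -/
theorem measurableSet_prod_apply_eq (o : Option X) :
    MeasurableSet {p : KilledPath X × ℝ≥0 | p.1 p.2 = o} := by
  set δ : ℕ → ℝ≥0 := fun n => ((n : ℝ≥0) + 1)⁻¹ with hδ
  have hpos : ∀ n, 0 < δ n := fun n => by positivity
  have hlim : Tendsto δ atTop (𝓝 0) := by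
    simpa [hδ, one_div] using tendsto_one_div_add_atTop_nhds_zero_nat (𝕜 := ℝ≥0)
  -- The values at the rounded times are eventually equal to the true value, so the event is a
  -- countable lower limit of events that depend on grid times only.
  have : {p : KilledPath X × ℝ≥0 | p.1 p.2 = o} =
      ⋃ N : ℕ, ⋂ n ∈ Set.Ici N, {p : KilledPath X × ℝ≥0 | p.1 (roundUp (δ n) p.2) = o} := by
    ext p
    have hev := p.1.eventually_apply_roundUp hpos hlim p.2
    simp only [Set.mem_iUnion, Set.mem_iInter, Set.mem_ofPred_eq, Set.mem_Ici]
    constructor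
    · rintro rfl
      exact eventually_atTop.1 hev
    · intro h
      obtain ⟨n, h1, h2⟩ := (hev.and (eventually_atTop.2 h)).exists
      exact h1.symm.trans h2
  rw [this]
  exact MeasurableSet.iUnion fun N => MeasurableSet.biInter (Set.to_countable _) fun n _ =>
    measurableSet_prod_roundUp_eq _ _

theorem measurableSet_time_apply_eq (w : KilledPath X) (o : Option X) :
    MeasurableSet {t : ℝ≥0 | w t = o} :=
  measurable_prodMk_left (measurableSet_prod_apply_eq o)

theorem measurable_killAt [Finite X] :
    Measurable fun p : KilledPath X × ℝ≥0 => p.1.killAt p.2 := by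
  classical
  refine measurable_of_measurableSet_apply_eq fun s o => ?_
  have h1 : MeasurableSet {p : KilledPath X × ℝ≥0 | s < p.2} :=
    measurableSet_lt measurable_const measurable_snd
  have h2 : MeasurableSet {p : KilledPath X × ℝ≥0 | p.1 s = o} :=
    measurable_fst (measurableSet_apply_eq s o)
  have : {p : KilledPath X × ℝ≥0 | (p.1.killAt p.2) s = o} =
      ({p | s < p.2} ∩ {p | p.1 s = o}) ∪ ({p | s < p.2}ᶜ ∩ {_p | none = o}) := by
    ext p
    by_cases hs : s < p.2 <;> simp [killAt, hs]
  rw [this]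
  exact (h1.inter h2).union (h1.compl.inter (MeasurableSet.const _))

instance : SFinite timeMeasure := by unfold timeMeasure; infer_instance

/-- Writing the integrand as a function of the state, zero at the cemetery, puts it in the form
covered by `measurable_comp_of_measurableSet_fiber`. -/
theorem localTime_eq_integral_elim [DecidableEq X] (m : X → ℝ) (w : KilledPath X) (u : X) :
    w.localTime m u = ∫ s, (w s).elim 0 (Pi.single u (m u)⁻¹) ∂timeMeasure := by
  unfold localTime
  congr 1
  funext s
  rcases w s with _ | v
  · simp
  · by_cases huv : v = u
    · subst huv; simp
    · simp [huv]

theorem measurable_localTime [Finite X] (m : X → ℝ) :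
    Measurable fun w : KilledPath X => w.localTime m := by
  classical
  refine measurable_pi_lambda _ fun u => ?_
  simp_rw [localTime_eq_integral_elim]
  exact (measurable_comp_of_measurableSet_fiber measurableSet_prod_apply_eq
    fun o => o.elim 0 (Pi.single u (m u)⁻¹)).stronglyMeasurable.integral_prod_right.measurable

theorem localTime_nonneg {m : X → ℝ} (hm : ∀ u, 0 ≤ m u) (w : KilledPath X) (u : X) :
    0 ≤ w.localTime m u := by
  refine integral_nonneg fun s => ?_
  dsimp only
  split_ifs
  exacts [inv_nonneg.2 (hm u), le_rfl]

theorem integral_timeMeasure {E : Type*} [NormedAddCommGroup E] [NormedSpace ℝ E] {f : ℝ≥0 → E}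
    (hf : StronglyMeasurable f) :
    ∫ t, f t ∂timeMeasure = ∫ t in Set.Ioi (0 : ℝ), f t.toNNReal := by
  rw [timeMeasure, integral_map measurable_real_toNNReal.aemeasurable hf.aestronglyMeasurable,
    integral_Ici_eq_integral_Ioi]

theorem integrable_timeMeasure_iff {E : Type*} [NormedAddCommGroup E] [NormedSpace ℝ E]
    {f : ℝ≥0 → E} (hf : StronglyMeasurable f) :
    Integrable f timeMeasure ↔ IntegrableOn (fun t : ℝ => f t.toNNReal) (Set.Ioi 0) := by
  rw [timeMeasure, integrable_map_measure hf.aestronglyMeasurable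
    measurable_real_toNNReal.aemeasurable, ← integrableOn_Ici_iff_integrableOn_Ioi]
  rfl

/-- A function of the state, extended by `0` at the cemetery, along a path. -/
noncomputable def along (w : KilledPath X) (θ : X → ℝ) (t : ℝ) : ℝ :=
  (w t.toNNReal).elim 0 θ

theorem measurable_along [Finite X] (w : KilledPath X) (θ : X → ℝ) : Measurable (w.along θ) :=
  (measurable_comp_of_measurableSet_fiber (w.measurableSet_time_apply_eq)
    (fun o => o.elim 0 θ)).comp measurable_real_toNNReal

theorem norm_elim_le [Fintype X] (o : Option X) (θ : X → ℝ) : ‖o.elim 0 θ‖ ≤ ∑ u, ‖θ u‖ := by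
  cases o with
  | none => simpa using Finset.sum_nonneg fun u _ => norm_nonneg (θ u)
  | some u =>
    exact Finset.single_le_sum (f := fun u => ‖θ u‖) (fun _ _ => norm_nonneg _)
      (Finset.mem_univ u)

theorem intervalIntegrable_along [Fintype X] (w : KilledPath X) (θ : X → ℝ) (a b : ℝ) :
    IntervalIntegrable (w.along θ) volume a b :=
  (intervalIntegrable_const (c := ∑ u, ‖θ u‖)).mono_fun
    (w.measurable_along θ).aestronglyMeasurable
    (ae_of_all _ fun _ => (norm_elim_le _ θ).trans (le_abs_self _))

/-- The local time at `u` of the path killed at `t` is the occupation integral up to `t`. -/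
theorem localTime_killAt [DecidableEq X] [Finite X] (m : X → ℝ) (w : KilledPath X) (t : ℝ≥0)
    (u : X) : (w.killAt t).localTime m u =
      ∫ s in (0 : ℝ)..t, w.along (Pi.single u (m u)⁻¹) s := by
  classical
  have hmeas : StronglyMeasurable fun s : ℝ≥0 =>
      ((w.killAt t) s).elim 0 (Pi.single u (m u)⁻¹ : X → ℝ) :=
    (measurable_comp_of_measurableSet_fiber (w.killAt t).measurableSet_time_apply_eq
      fun o => o.elim 0 (Pi.single u (m u)⁻¹)).stronglyMeasurable
  -- The killed path is already in the cemetery at time `t`, so its integrand lives on an open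
  -- interval. The right endpoint is dropped as a null set.
  rw [localTime_eq_integral_elim, integral_timeMeasure hmeas,
    intervalIntegral.integral_of_le t.coe_nonneg, integral_Ioc_eq_integral_Ioo]
  have hind : ∀ s ∈ Set.Ioi (0 : ℝ),
      ((w.killAt t) s.toNNReal).elim 0 (Pi.single u (m u)⁻¹ : X → ℝ) =
      (Set.Iio (t : ℝ)).indicator (w.along (Pi.single u (m u)⁻¹)) s := by
    intro s hs
    have hs' : s.toNNReal < t ↔ s < t := by
      rw [← NNReal.coe_lt_coe, Real.coe_toNNReal _ (le_of_lt hs)]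
    by_cases hst : s < t
    · rw [Set.indicator_of_mem (show s ∈ Set.Iio (t : ℝ) from hst), along]
      simp [killAt, hs'.2 hst]
    · rw [Set.indicator_of_notMem (show s ∉ Set.Iio (t : ℝ) from hst)]
      simp [killAt, mt hs'.1 hst]
  rw [setIntegral_congr_fun measurableSet_Ioi hind, setIntegral_indicator measurableSet_Iio]
  rfl

theorem sum_mul_localTime_killAt [DecidableEq X] [Fintype X] (m ξ : X → ℝ) (w : KilledPath X)
    (t : ℝ≥0) : ∑ u, ξ u * (w.killAt t).localTime m u =
      ∫ s in (0 : ℝ)..t, w.along (fun u => ξ u * (m u)⁻¹) s := by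
  simp_rw [localTime_killAt, ← intervalIntegral.integral_const_mul]
  rw [← intervalIntegral.integral_finsetSum fun u _ =>
    (w.intervalIntegrable_along _ _ _).const_mul _]
  congr 1
  funext s
  simp only [along]
  rcases w s.toNNReal with _ | v
  · simp
  · simp [Pi.single_apply]

theorem sum_localTime_killAt_le [DecidableEq X] [Fintype X] {m : X → ℝ} (hm : ∀ u, 0 ≤ m u)
    (w : KilledPath X) (t : ℝ≥0) :
    ∑ u, (w.killAt t).localTime m u ≤ (∑ u, (m u)⁻¹) * t := by
  have h := w.sum_mul_localTime_killAt m 1 t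
  simp only [Pi.one_apply, one_mul] at h
  rw [h]
  have hle : ∀ s ∈ Set.Icc (0 : ℝ) t, w.along (fun u => (m u)⁻¹) s ≤ ∑ u, (m u)⁻¹ := by
    intro s _
    refine (le_abs_self _).trans ((norm_elim_le _ _).trans_eq ?_)
    exact Finset.sum_congr rfl fun u _ => Real.norm_of_nonneg (inv_nonneg.2 (hm u))
  refine (intervalIntegral.integral_mono_on t.2 (w.intervalIntegrable_along _ _ _)
    intervalIntegrable_const hle).trans_eq ?_
  simp [mul_comm]

/-- Riemann sums with right endpoints converge to the integral along a path. -/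
theorem tendsto_riemann_sum_along [Fintype X] (w : KilledPath X) (θ : X → ℝ) {t : ℝ≥0}
    (ht : 0 < t) :
    Tendsto (fun n : ℕ => ∑ i ∈ Finset.range (n + 1),
      (t / ((n : ℝ) + 1)) * (w ((i + 1 : ℕ) * (t / (n + 1)))).elim 0 θ) atTop
      (𝓝 (∫ s in (0 : ℝ)..t, w.along θ s)) := by
  set δ : ℕ → ℝ≥0 := fun n => t / ((n : ℝ≥0) + 1) with hδ
  have hpos : ∀ n, 0 < δ n := fun n => by positivity
  have hlim : Tendsto δ atTop (𝓝 0) := by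
    have := (tendsto_one_div_add_atTop_nhds_zero_nat (𝕜 := ℝ≥0)).const_mul t
    simpa [hδ, div_eq_mul_inv] using this
  have hconv : Tendsto
      (fun n => ∫ s in (0 : ℝ)..t, (w (roundUp (δ n) s.toNNReal)).elim 0 θ) atTop
      (𝓝 (∫ s in (0 : ℝ)..t, w.along θ s)) := by
    refine intervalIntegral.tendsto_integral_filter_of_dominated_convergence
      (fun _ => ∑ u, ‖θ u‖) (Eventually.of_forall fun n => ?_)
      (Eventually.of_forall fun n => ae_of_all _ fun s _ => norm_elim_le _ θ)
      intervalIntegrable_const (ae_of_all _ fun s _ => ?_)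
    · have h1 := measurable_comp_of_measurableSet_fiber (w.measurableSet_time_apply_eq)
        (fun o => o.elim 0 θ)
      exact (h1.comp ((measurable_roundUp _).comp
        measurable_real_toNNReal)).aestronglyMeasurable
    · refine tendsto_const_nhds.congr' ?_
      filter_upwards [w.eventually_apply_roundUp hpos hlim s.toNNReal] with n hn
      rw [along, hn]
  refine hconv.congr fun n => ?_
  -- On each half-open cell the rounded time is the right endpoint, so the integral of the rounded
  -- path is exactly the Riemann sum.
  have hstep : ∀ i : ℕ, ∀ s ∈ Set.Ioc ((i : ℝ) * δ n) ((i + 1 : ℕ) * δ n),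
      (w (roundUp (δ n) s.toNNReal)).elim 0 θ = (w ((i + 1 : ℕ) * δ n)).elim 0 θ := by
    intro i s hs
    have hs0 : 0 ≤ s := le_trans (by positivity) hs.1.le
    rw [roundUp_eq (hpos n) (i := i), Nat.cast_add, Nat.cast_one]
    · rw [← NNReal.coe_lt_coe, Real.coe_toNNReal _ hs0]
      exact_mod_cast hs.1
    · rw [← NNReal.coe_le_coe, Real.coe_toNNReal _ hs0]
      exact_mod_cast hs.2
  have hle : ∀ i : ℕ, (i : ℝ) * δ n ≤ (i + 1 : ℕ) * δ n := fun i => by gcongr; simp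
  have hint : ∀ i : ℕ, ∫ s in (i : ℝ) * δ n..(i + 1 : ℕ) * δ n,
      (w (roundUp (δ n) s.toNNReal)).elim 0 θ = δ n * (w ((i + 1 : ℕ) * δ n)).elim 0 θ := by
    intro i
    rw [intervalIntegral.integral_of_le (hle i), setIntegral_congr_fun measurableSet_Ioc (hstep i),
      ← intervalIntegral.integral_of_le (hle i), intervalIntegral.integral_const, smul_eq_mul]
    push_cast
    ring
  have hsum := intervalIntegral.sum_integral_adjacent_intervals (μ := volume)
    (f := fun s : ℝ => (w (roundUp (δ n) s.toNNReal)).elim 0 θ) (a := fun i : ℕ => (i : ℝ) * δ n)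
    (n := n + 1) (fun i _ => by
      refine (intervalIntegrable_const (c := (w ((i + 1 : ℕ) * δ n)).elim 0 θ)).congr ?_
      rw [Set.uIoc_of_le (hle i)]
      exact (hstep i · · |>.symm))
  have hend : ((n + 1 : ℕ) : ℝ) * δ n = t := by
    rw [hδ]
    push_cast
    field_simp
  rw [hend, Nat.cast_zero, zero_mul] at hsum
  rw [← hsum]
  refine Finset.sum_congr rfl fun i _ => ?_
  rw [hint i]
  simp [hδ]

end KilledPath

/-! ### The Feynman–Kac formula -/

section FeynmanKac

variable {X : Type*}

theorem norm_prod_elim_le (φ : X → ℂ) (hφ : ∀ u, ‖φ u‖ = 1) (k : ℕ) (f : ℕ → Option X) :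
    ‖∏ i ∈ Finset.range k, (f i).elim 1 φ‖ ≤ 1 := by
  rw [norm_prod]
  refine (Finset.prod_eq_one fun i _ => ?_).le
  cases f i with
  | none => simp
  | some u => exact hφ u

theorem measurable_prod_elim [Finite X] (φ : X → ℂ) (k : ℕ) (t : ℕ → ℝ≥0) :
    Measurable fun w : KilledPath X => ∏ i ∈ Finset.range k, (w (t i)).elim 1 φ :=
  Finset.measurable_fun_prod _ fun i _ => KilledPath.measurable_comp_of_measurableSet_fiber
    (KilledPath.measurableSet_apply_eq (t i)) fun o => o.elim 1 φ

variable [Fintype X] [DecidableEq X] {L : Matrix X X ℝ}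
  {P : X → Measure (KilledPath X)}

theorem IsMarkovFamily.ae_apply_zero (hP : IsMarkovFamily L P) (x : X) :
    ∀ᵐ w ∂(P x), w 0 = some x := by
  have := hP.isProbabilityMeasure x
  have h0 : (P x).real {w | w 0 = some x} = 1 := by
    simpa using hP.finiteDimensional 0 (fun _ => 0) (fun _ => x) monotone_const rfl
  rw [measureReal_def, ENNReal.toReal_eq_one_iff] at h0
  exact (mem_ae_iff_prob_eq_one (KilledPath.measurableSet_apply_eq 0 (some x))).2 h0

theorem IsMarkovFamily.real_apply_eq (hP : IsMarkovFamily L P) (x y : X) (t : ℝ≥0) :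
    (P x).real {w | w t = some y} = NormedSpace.exp ((t : ℝ) • L) x y := by
  have h := hP.finiteDimensional 1 (fun i => i * t) (fun i => if i = 0 then x else y)
    (fun i j hij => by dsimp only; gcongr) (by simp)
  simp only [if_true, Finset.range_one, Finset.prod_singleton, zero_add, Nat.cast_one, one_mul,
    Nat.cast_zero, zero_mul, NNReal.coe_zero, sub_zero, one_ne_zero, if_false] at h
  rw [← h]
  refine measureReal_congr (eventuallyEq_set.2 ?_)
  filter_upwards [hP.ae_apply_zero x] with w hw
  refine ⟨fun hy i hi => ?_, fun hi => by simpa using hi 1 le_rfl⟩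
  interval_cases i
  · simpa using hw
  · simpa using hy

/-- Along a regular time grid, multiplicative functionals of a Markov process are computed by
powers of the transition matrix twisted by the weights. -/
theorem IsMarkovFamily.setIntegral_prod_elim (hP : IsMarkovFamily L P) (x : X) (δ : ℝ≥0)
    (φ : X → ℂ) (hφ : ∀ u, ‖φ u‖ = 1) (n k : ℕ) (hk : k ≤ n) (y : ℕ → X) :
    ∫ w in {w : KilledPath X | ∀ i ≤ n, k ≤ i → w (i * δ) = some (y i)},
        ∏ i ∈ Finset.range k, (w ((i + 1 : ℕ) * δ)).elim 1 φ ∂(P x) =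
      (((NormedSpace.exp ((δ : ℝ) • L)).map ((↑) : ℝ → ℂ) * Matrix.diagonal φ) ^ k) x (y k) *
        ∏ i ∈ Finset.Ico k n, (NormedSpace.exp ((δ : ℝ) • L) (y i) (y (i + 1)) : ℂ) := by
  have := hP.isProbabilityMeasure x
  -- The finite-dimensional laws prescribe the state at every grid time, which is the case `k = 0`.
  -- Each step frees one more state, and summing over it is a matrix product. The sequence `y`
  -- varies because the freed coordinate is overwritten.
  induction k generalizing y with
  | zero =>
    simp only [Finset.range_zero, Finset.prod_empty, pow_zero, Nat.zero_le, forall_const]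
    rw [setIntegral_const]
    by_cases hy : y 0 = x
    · have h := hP.finiteDimensional n (fun i => i * δ) y (fun i j hij => by dsimp only; gcongr)
        (by simp)
      have hd : ∀ i : ℕ, (((i + 1 : ℕ) * δ : ℝ≥0) : ℝ) - ((i * δ : ℝ≥0) : ℝ) = δ := by
        intro i; push_cast; ring
      simp only [hd, hy] at h
      rw [h, hy, Matrix.one_apply_eq, Finset.range_eq_Ico]
      simp
    · rw [Matrix.one_apply_ne (Ne.symm hy)]
      have hz : (P x).real {w : KilledPath X | ∀ i ≤ n, w (i * δ) = some (y i)} = 0 := by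
        rw [measureReal_def, measure_eq_zero_iff_ae_notMem.2, ENNReal.toReal_zero]
        filter_upwards [hP.ae_apply_zero x] with w hw hmem
        have := hmem 0 (Nat.zero_le _)
        rw [Nat.cast_zero, zero_mul, hw] at this
        exact hy (Option.some.inj this).symm
      rw [hz]
      simp
  | succ k ih =>
    have hset : {w : KilledPath X | ∀ i ≤ n, k + 1 ≤ i → w (i * δ) = some (y i)} =
        ⋃ u : X, {w : KilledPath X | ∀ i ≤ n, k ≤ i →
          w (i * δ) = some (Function.update y k u i)} := by
      ext w
      simp only [Set.mem_ofPred_eq, Set.mem_iUnion]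
      constructor
      · intro h
        -- By absorption, a path alive at the next grid time is alive at this one, so the states of
        -- `X` exhaust the cases.
        have hne : w (k * δ) ≠ none := by
          intro hnone
          have h1 := w.absorbed (k * δ) ((k + 1 : ℕ) * δ) (by gcongr; simp) hnone
          rw [h (k + 1) hk le_rfl] at h1
          simp at h1
        obtain ⟨u, hu⟩ := Option.ne_none_iff_exists'.1 hne
        refine ⟨u, fun i hi hki => ?_⟩
        rcases hki.eq_or_lt with rfl | hlt
        · rw [hu, Function.update_self]
        · rw [h i hi hlt, Function.update_of_ne hlt.ne']
      · rintro ⟨u, hu⟩ i hi hki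
        rw [hu i hi (by omega), Function.update_of_ne (by omega)]
    have hms : ∀ u, MeasurableSet {w : KilledPath X | ∀ i ≤ n, k ≤ i →
        w (i * δ) = some (Function.update y k u i)} := by
      intro u
      simp only [Set.ofPred_forall]
      exact MeasurableSet.iInter fun i => MeasurableSet.iInter fun _ =>
        MeasurableSet.iInter fun _ => KilledPath.measurableSet_apply_eq _ _
    have hdisj : Pairwise (Function.onFun Disjoint fun u => {w : KilledPath X | ∀ i ≤ n, k ≤ i →
        w (i * δ) = some (Function.update y k u i)}) := by
      intro u v huv
      refine Set.disjoint_left.2 fun w hu hv => huv ?_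
      have h1 := hu k (by omega) le_rfl
      have h2 := hv k (by omega) le_rfl
      rw [Function.update_self] at h1 h2
      exact Option.some.inj (h1.symm.trans h2)
    rw [hset, integral_iUnion_fintype hms hdisj fun u => (Integrable.of_bound (C := 1)
      (measurable_prod_elim φ (k + 1) _).aestronglyMeasurable
      (ae_of_all _ fun w => norm_prod_elim_le φ hφ _ _)).integrableOn]
    have hpiece : ∀ u, ∫ w in {w : KilledPath X | ∀ i ≤ n, k ≤ i →
        w (i * δ) = some (Function.update y k u i)},
          ∏ i ∈ Finset.range (k + 1), (w ((i + 1 : ℕ) * δ)).elim 1 φ ∂(P x) =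
        (((NormedSpace.exp ((δ : ℝ) • L)).map ((↑) : ℝ → ℂ) * Matrix.diagonal φ) ^ k) x u *
          ((NormedSpace.exp ((δ : ℝ) • L) u (y (k + 1)) : ℂ) * φ (y (k + 1))) *
          ∏ i ∈ Finset.Ico (k + 1) n, (NormedSpace.exp ((δ : ℝ) • L) (y i) (y (i + 1)) : ℂ) := by
      intro u
      have hcongr : ∀ w ∈ {w : KilledPath X | ∀ i ≤ n, k ≤ i →
          w (i * δ) = some (Function.update y k u i)},
          ∏ i ∈ Finset.range (k + 1), (w ((i + 1 : ℕ) * δ)).elim 1 φ =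
          (∏ i ∈ Finset.range k, (w ((i + 1 : ℕ) * δ)).elim 1 φ) * φ (y (k + 1)) := by
        intro w hw
        rw [Finset.prod_range_succ, hw (k + 1) hk (by omega), Function.update_of_ne (by omega)]
        rfl
      rw [setIntegral_congr_fun (hms u) hcongr, integral_mul_const, ih (by omega),
        Function.update_self, Finset.prod_eq_prod_Ico_succ_bot (by omega : k < n),
        Function.update_self, Function.update_of_ne (by omega),
        Finset.prod_congr rfl fun i hi => ?_]
      · ring
      · have := (Finset.mem_Ico.1 hi).1
        rw [Function.update_of_ne (by omega), Function.update_of_ne (by omega)]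
    simp_rw [hpiece]
    rw [← Finset.sum_mul, pow_succ, Matrix.mul_apply]
    simp [Matrix.mul_diagonal]

/-- The **Feynman–Kac formula** with a purely imaginary potential. -/
theorem IsMarkovFamily.feynmanKac (hP : IsMarkovFamily L P) (θ : X → ℝ) (x y : X) {t : ℝ≥0}
    (ht : 0 < t) :
    ∫ w in {w : KilledPath X | w t = some y},
        Complex.exp (((∫ s in (0 : ℝ)..t, w.along θ s : ℝ) : ℂ) * Complex.I) ∂(P x) =
      NormedSpace.exp ((t : ℝ) • (L.map ((↑) : ℝ → ℂ) +
        Matrix.diagonal fun u => (θ u : ℂ) * Complex.I)) x y := by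
  have := hP.isProbabilityMeasure x
  have : Nonempty X := ⟨x⟩
  set D : Matrix X X ℂ := Matrix.diagonal fun u => (θ u : ℂ) * Complex.I with hD
  set φ : ℕ → X → ℂ := fun n u => Complex.exp (((t / ((n : ℝ) + 1) * θ u : ℝ) : ℂ) * Complex.I)
    with hφ
  have hφ1 : ∀ n u, ‖φ n u‖ = 1 := fun n u => Complex.norm_exp_ofReal_mul_I _
  set δ : ℕ → ℝ≥0 := fun n => t / ((n : ℝ≥0) + 1) with hδ
  have hend : ∀ n, ((n + 1 : ℕ) : ℝ≥0) * δ n = t := by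
    intro n
    rw [hδ]
    push_cast
    field_simp
  have hmat := tendsto_pi_nhds.1 (tendsto_pi_nhds.1 (Matrix.tendsto_exp_mul_exp_pow
    ((t : ℝ) • L.map ((↑) : ℝ → ℂ)) ((t : ℝ) • D)) x) y
  rw [← smul_add] at hmat
  have hint : Tendsto (fun n : ℕ => ∫ w in {w : KilledPath X | w t = some y},
      ∏ i ∈ Finset.range (n + 1), (w ((i + 1 : ℕ) * δ n)).elim 1 (φ n) ∂(P x)) atTop
      (𝓝 (∫ w in {w : KilledPath X | w t = some y},
        Complex.exp (((∫ s in (0 : ℝ)..t, w.along θ s : ℝ) : ℂ) * Complex.I) ∂(P x))) := by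
    refine tendsto_integral_of_dominated_convergence (fun _ => 1)
      (fun n => (measurable_prod_elim (φ n) (n + 1) _).aestronglyMeasurable)
      (integrable_const _) (fun n => ae_of_all _ fun w => norm_prod_elim_le (φ n) (hφ1 n) _ _)
      (ae_of_all _ fun w => ?_)
    have h1 := w.tendsto_riemann_sum_along θ ht
    have h2 : Continuous fun r : ℝ => Complex.exp ((r : ℂ) * Complex.I) := by fun_prop
    -- The product of the phases is the exponential of `i` times the Riemann sum. The weight `1` at
    -- the cemetery matches the value `0` given to `θ` there.
    refine ((h2.tendsto _).comp h1).congr fun n => ?_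
    simp only [Function.comp_apply]
    rw [Complex.ofReal_sum, Finset.sum_mul, Complex.exp_sum]
    refine Finset.prod_congr rfl fun i _ => ?_
    rw [hδ]
    dsimp only
    cases w ((i + 1 : ℕ) * (t / ((n : ℝ≥0) + 1))) with
    | none => simp
    | some u => rfl
  refine tendsto_nhds_unique hint (hmat.congr fun n => ?_)
  -- With `k` equal to the number of steps, only the final state stays prescribed, and the
  -- expectation is an entry of the Trotter product.
  have h := hP.setIntegral_prod_elim x (δ n) (φ n) (hφ1 n) (n + 1) (n + 1) le_rfl (fun _ => y)
  have hset : {w : KilledPath X | ∀ i ≤ n + 1, n + 1 ≤ i → w (i * δ n) = some y} =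
      {w : KilledPath X | w t = some y} := by
    ext w
    constructor
    · intro hw
      have := hw (n + 1) le_rfl le_rfl
      rwa [hend] at this
    · rintro hw i h1 h2
      obtain rfl := le_antisymm h1 h2
      rw [hend]
      exact hw
  rw [hset] at h
  rw [h, Finset.Ico_self, Finset.prod_empty, mul_one]
  have e1 : NormedSpace.exp (((n : ℝ) + 1)⁻¹ • (t : ℝ) • L.map ((↑) : ℝ → ℂ)) =
      (NormedSpace.exp ((δ n : ℝ) • L)).map ((↑) : ℝ → ℂ) := by
    rw [← Matrix.exp_map_ofReal]
    congr 1
    ext i j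
    simp only [Matrix.smul_apply, Matrix.map_apply, hδ, Complex.real_smul, smul_eq_mul]
    push_cast
    ring
  have e2 : NormedSpace.exp (((n : ℝ) + 1)⁻¹ • (t : ℝ) • D) = Matrix.diagonal (φ n) := by
    rw [hD, ← Matrix.diagonal_smul, ← Matrix.diagonal_smul, Matrix.exp_diagonal]
    congr 1
    funext u
    rw [Pi.coe_exp]
    simp only [Pi.smul_apply, hφ, Complex.exp_eq_exp_ℂ, Complex.real_smul]
    congr 1
    push_cast
    ring
  rw [e1, e2]

end FeynmanKac

/-! ### The Dirichlet form, the potential and the reference measure -/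

/-- The Dirichlet form of a generator with respect to an excessive measure. -/
theorem two_mul_re_energyForm {X : Type*} [Fintype X] {L : Matrix X X ℝ} (m κ μ : X → ℝ)
    (hκ : ∀ u, ∑ v, L u v = -κ u) (hμ : ∀ v, ∑ u, m u * L u v = -μ v) (z : X → ℂ) :
    2 * (energyForm L m z).re = -(∑ u, ∑ v, m u * L u v * ‖z u - z v‖ ^ 2) -
      ∑ u, (m u * κ u + μ u) * ‖z u‖ ^ 2 := by
  have h1 : ∀ u, m u * κ u * ‖z u‖ ^ 2 = -∑ v, m u * L u v * ‖z u‖ ^ 2 := by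
    intro u
    rw [← Finset.sum_mul, ← Finset.mul_sum, hκ]
    ring
  have h2 : ∑ u, μ u * ‖z u‖ ^ 2 = -∑ u, ∑ v, m u * L u v * ‖z v‖ ^ 2 := by
    rw [Finset.sum_comm, ← Finset.sum_neg_distrib]
    refine Finset.sum_congr rfl fun v _ => ?_
    rw [← Finset.sum_mul, hμ]
    ring
  have h3 : (energyForm L m z).re =
      ∑ u, ∑ v, m u * L u v * ((z u).re * (z v).re + (z u).im * (z v).im) := by
    rw [energyForm, Complex.re_sum]
    refine Finset.sum_congr rfl fun u _ => ?_
    rw [Finset.sum_mul, Finset.sum_mul, Complex.re_sum]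
    refine Finset.sum_congr rfl fun v _ => ?_
    simp
    ring
  simp only [add_mul, Finset.sum_add_distrib, h1, h2, Finset.sum_neg_distrib]
  rw [h3, Finset.mul_sum]
  simp only [Finset.mul_sum, ← Finset.sum_neg_distrib, ← Finset.sum_add_distrib,
    ← Finset.sum_sub_distrib]
  refine Finset.sum_congr rfl fun u _ => Finset.sum_congr rfl fun v _ => ?_
  simp only [Complex.sq_norm, Complex.normSq_apply, Complex.sub_re, Complex.sub_im]
  ring

section Potential

variable {X : Type*} [Fintype X] [DecidableEq X] {L : Matrix X X ℝ}
  {P : X → Measure (KilledPath X)}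

theorem IsMarkovFamily.exp_smul_nonneg (hP : IsMarkovFamily L P) {t : ℝ} (ht : 0 ≤ t) (x y : X) :
    0 ≤ NormedSpace.exp (t • L) x y := by
  have : (P x).real {w | w ⟨t, ht⟩ = some y} = NormedSpace.exp (t • L) x y :=
    hP.real_apply_eq x y ⟨t, ht⟩
  rw [← this]
  exact measureReal_nonneg

theorem IsMarkovFamily.sum_exp_smul_le_one (hP : IsMarkovFamily L P) {t : ℝ} (ht : 0 ≤ t) (x : X) :
    ∑ y, NormedSpace.exp (t • L) x y ≤ 1 := by
  have := hP.isProbabilityMeasure x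
  have h : ∀ y, NormedSpace.exp (t • L) x y =
      (P x).real {w | w ⟨t, ht⟩ = some y} := fun y => (hP.real_apply_eq x y ⟨t, ht⟩).symm
  simp_rw [h]
  rw [← measureReal_biUnion_finset]
  · exact measureReal_le_one
  · intro u _ v _ huv
    exact Set.disjoint_left.2 fun w hu hv => huv (Option.some.inj (hu.symm.trans hv))
  · exact fun u _ => KilledPath.measurableSet_apply_eq _ _

/-- Almost every path is eventually in the cemetery and stays there, so the indicators of being at
`y` tend to zero boundedly. -/
theorem IsMarkovFamily.tendsto_exp_smul (hP : IsMarkovFamily L P) (hlife : HasFiniteLifetime P)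
    (x y : X) : Tendsto (fun n : ℕ => NormedSpace.exp ((n : ℝ) • L) x y) atTop (𝓝 0) := by
  have := hP.isProbabilityMeasure x
  have hm : ∀ n : ℕ, MeasurableSet {w : KilledPath X | w (n : ℝ≥0) = some y} :=
    fun n => KilledPath.measurableSet_apply_eq _ _
  have h : Tendsto (fun n : ℕ => ∫ w, {w : KilledPath X | w (n : ℝ≥0) = some y}.indicator
      (fun _ => (1 : ℝ)) w ∂(P x)) atTop (𝓝 (∫ _, (0 : ℝ) ∂(P x))) := by
    refine tendsto_integral_of_dominated_convergence (fun _ => 1)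
      (fun n => (measurable_const.indicator (hm n)).aestronglyMeasurable) (integrable_const _)
      (fun n => ae_of_all _ fun w => ?_) ?_
    · refine (norm_indicator_le_norm_self _ _).trans ?_
      simp
    · filter_upwards [hlife x] with w ⟨t, ht⟩
      refine tendsto_const_nhds.congr' ?_
      obtain ⟨N, hN⟩ := exists_nat_ge t
      filter_upwards [eventually_ge_atTop N] with n hn
      rw [Set.indicator_of_notMem]
      intro hmem
      have h1 : w (n : ℝ≥0) = none := w.absorbed t n (hN.trans (by exact_mod_cast hn)) ht
      have h2 : w (n : ℝ≥0) = some y := hmem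
      rw [h1] at h2
      simp at h2
  rw [integral_zero] at h
  refine h.congr fun n => ?_
  rw [integral_indicator_const _ (hm n), smul_eq_mul, mul_one, hP.real_apply_eq]
  rfl

theorem IsMarkovFamily.generator_nonneg (hP : IsMarkovFamily L P) {x y : X} (hxy : x ≠ y) :
    0 ≤ L x y := by
  have hd := L.hasDerivAt_exp_smul_apply x y 0
  simp only [zero_smul, NormedSpace.exp_zero, Matrix.one_apply, mul_ite, mul_one, mul_zero,
    Finset.sum_ite_eq', Finset.mem_univ, if_true] at hd
  have hs := (hasDerivAt_iff_tendsto_slope_zero.1 hd).mono_left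
    (nhdsWithin_mono 0 (fun t (ht : 0 < t) => ht.ne') : 𝓝[>] (0 : ℝ) ≤ 𝓝[≠] 0)
  refine ge_of_tendsto hs ?_
  filter_upwards [self_mem_nhdsWithin] with t ht
  have ht' : 0 ≤ t := le_of_lt ht
  rw [zero_add, zero_smul, NormedSpace.exp_zero, Matrix.one_apply_ne hxy, sub_zero, smul_eq_mul]
  exact mul_nonneg (inv_nonneg.2 ht') (hP.exp_smul_nonneg ht' x y)

theorem IsMarkovFamily.generator_sum_nonpos (hP : IsMarkovFamily L P) (x : X) :
    ∑ y, L x y ≤ 0 := by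
  have hd := HasDerivAt.fun_sum fun y (_ : y ∈ (Finset.univ : Finset X)) =>
    L.hasDerivAt_exp_smul_apply x y 0
  simp only [zero_smul, NormedSpace.exp_zero, Matrix.one_apply, mul_ite, mul_one, mul_zero,
    Finset.sum_ite_eq', Finset.mem_univ, if_true] at hd
  have hs := (hasDerivAt_iff_tendsto_slope_zero.1 hd).mono_left
    (nhdsWithin_mono 0 (fun t (ht : 0 < t) => ht.ne') : 𝓝[>] (0 : ℝ) ≤ 𝓝[≠] 0)
  refine le_of_tendsto hs ?_
  filter_upwards [self_mem_nhdsWithin] with t ht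
  have ht' : 0 ≤ t := le_of_lt ht
  simp only [zero_add, zero_smul, NormedSpace.exp_zero, Matrix.one_apply, Finset.sum_ite_eq,
    Finset.mem_univ, if_true, smul_eq_mul]
  exact mul_nonpos_of_nonneg_of_nonpos (inv_nonneg.2 ht')
    (sub_nonpos.2 (hP.sum_exp_smul_le_one ht' x))

theorem IsMarkovFamily.integrableOn_exp_smul (hP : IsMarkovFamily L P)
    (hlife : HasFiniteLifetime P) (x y : X) :
    IntegrableOn (fun t : ℝ => NormedSpace.exp (t • L) x y) (Set.Ioi 0) := by
  have : Nonempty X := ⟨x⟩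
  simpa using L.integrableOn_pow_mul_exp_smul (hP.tendsto_exp_smul hlife) 0 0 x y

/-- The inverse of a singular matrix is zero by convention, so invertibility has to be proved: the
integrated semigroup is a right inverse. -/
theorem IsMarkovFamily.neg_mul_potential (hP : IsMarkovFamily L P) (hlife : HasFiniteLifetime P) :
    (-L) * potential L = 1 := by
  have h := L.neg_mul_integral_exp_smul (hP.integrableOn_exp_smul hlife)
  rw [potential, Matrix.inv_eq_right_inv h, h]

theorem IsMarkovFamily.potential_apply (hP : IsMarkovFamily L P) (hlife : HasFiniteLifetime P)
    (x y : X) : potential L x y = ∫ t in Set.Ioi (0 : ℝ), NormedSpace.exp (t • L) x y := by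
  rw [potential, Matrix.inv_eq_right_inv
    (L.neg_mul_integral_exp_smul (hP.integrableOn_exp_smul hlife))]
  rfl

theorem IsMarkovFamily.potential_pos (hP : IsMarkovFamily L P) (hirr : IsIrreducibleFamily P)
    (hlife : HasFiniteLifetime P) (x y : X) : 0 < potential L x y := by
  rw [hP.potential_apply hlife]
  have := hP.isProbabilityMeasure x
  obtain ⟨t, ht⟩ := hirr x y
  have hpos : 0 < NormedSpace.exp ((t : ℝ) • L) x y := by
    rw [← hP.real_apply_eq]
    exact ENNReal.toReal_pos ht.ne' (measure_ne_top _ _)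
  have hc := L.continuous_exp_smul_apply x y
  rw [setIntegral_pos_iff_support_of_nonneg_ae _ (hP.integrableOn_exp_smul hlife x y)]
  -- By continuity the integrand stays positive near `t`. Only times to the right of `t` are used,
  -- since `t` may be `0`.
  · obtain ⟨ε, hε, hball⟩ := Metric.eventually_nhds_iff.1
      ((hc.tendsto (t : ℝ)).eventually (lt_mem_nhds hpos))
    refine lt_of_lt_of_le ?_ (measure_mono (s := Set.Ioo (t : ℝ) (t + ε)) fun s hs => ?_)
    · rw [Real.volume_Ioo]
      simpa using hε
    · refine ⟨(hball ?_).ne', t.coe_nonneg.trans_lt hs.1⟩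
      rw [Real.dist_eq, abs_of_pos (by linarith [hs.1])]
      linarith [hs.2]
  · filter_upwards [ae_restrict_mem measurableSet_Ioi] with s hs
    exact hP.exp_smul_nonneg (le_of_lt hs) x y

theorem IsMarkovFamily.refMeasure_pos (hP : IsMarkovFamily L P) (hirr : IsIrreducibleFamily P)
    (hlife : HasFiniteLifetime P) {μ : X → ℝ} (hμ : ∀ u, 0 ≤ μ u) (hμ_sum : ∑ u, μ u = 1) (u : X) :
    0 < refMeasure L μ u := by
  obtain ⟨v, -, hv⟩ := Finset.exists_ne_zero_of_sum_ne_zero (hμ_sum.trans_ne one_ne_zero)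
  refine Finset.sum_pos' (fun w _ => mul_nonneg (hμ w) (hP.potential_pos hirr hlife w u).le)
    ⟨v, Finset.mem_univ v, mul_pos ((hμ v).lt_of_ne' hv) (hP.potential_pos hirr hlife v u)⟩

theorem IsMarkovFamily.sum_refMeasure_mul (hP : IsMarkovFamily L P) (hlife : HasFiniteLifetime P)
    (μ : X → ℝ) (v : X) : ∑ u, refMeasure L μ u * L u v = -μ v := by
  have h : potential L * (-L) = 1 := mul_eq_one_comm.1 (hP.neg_mul_potential hlife)
  have h2 : Matrix.vecMul (refMeasure L μ) (-L) = μ := by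
    rw [refMeasure, Matrix.vecMul_vecMul, h, Matrix.vecMul_one]
  have h3 := congrFun h2 v
  simp only [Matrix.vecMul, dotProduct, Matrix.neg_apply, mul_neg, Finset.sum_neg_distrib] at h3
  linarith

/-- Both sums in the Dirichlet form are nonnegative. If they vanish, `z` is constant along the jumps
of `L` and is zero wherever there is killing; hence `Lz = 0`, and `z = 0` because `L` is invertible.
Irreducibility enters through the positivity of `m`. -/
theorem IsMarkovFamily.re_energyForm_neg (hP : IsMarkovFamily L P) (hirr : IsIrreducibleFamily P)
    (hlife : HasFiniteLifetime P) {μ : X → ℝ} (hμ : ∀ u, 0 ≤ μ u) (hμ_sum : ∑ u, μ u = 1)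
    {z : X → ℂ} (hz : z ≠ 0) : (energyForm L (refMeasure L μ) z).re < 0 := by
  have hm := hP.refMeasure_pos hirr hlife hμ hμ_sum
  set m := refMeasure L μ with hm_def
  have hform := two_mul_re_energyForm (L := L) m (fun u => -∑ v, L u v) μ (fun u => by simp)
    (hP.sum_refMeasure_mul hlife μ) z
  have hκ : ∀ u, 0 ≤ -∑ v, L u v := fun u => neg_nonneg.2 (hP.generator_sum_nonpos u)
  have ha : ∀ u v, 0 ≤ m u * L u v * ‖z u - z v‖ ^ 2 := by
    intro u v
    by_cases huv : u = v
    · simp [huv]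
    · exact mul_nonneg (mul_nonneg (hm u).le (hP.generator_nonneg huv)) (by positivity)
  have hb : ∀ u, 0 ≤ (m u * (-∑ v, L u v) + μ u) * ‖z u‖ ^ 2 := fun u =>
    mul_nonneg (add_nonneg (mul_nonneg (hm u).le (hκ u)) (hμ u)) (by positivity)
  have hA := Finset.sum_nonneg fun u (_ : u ∈ Finset.univ) =>
    Finset.sum_nonneg fun v (_ : v ∈ Finset.univ) => ha u v
  have hB := Finset.sum_nonneg fun u (_ : u ∈ Finset.univ) => hb u
  by_contra! hcon
  have hA0 : ∑ u, ∑ v, m u * L u v * ‖z u - z v‖ ^ 2 = 0 := by linarith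
  have hB0 : ∑ u, (m u * (-∑ v, L u v) + μ u) * ‖z u‖ ^ 2 = 0 := by linarith
  have hA1 : ∀ u v, L u v = 0 ∨ z v = z u := by
    intro u v
    have h1 := (Finset.sum_eq_zero_iff_of_nonneg fun u _ =>
      Finset.sum_nonneg fun v _ => ha u v).1 hA0 u (Finset.mem_univ u)
    have h2 := (Finset.sum_eq_zero_iff_of_nonneg fun v _ => ha u v).1 h1 v (Finset.mem_univ v)
    rcases mul_eq_zero.1 h2 with h3 | h3
    · exact Or.inl ((mul_eq_zero.1 h3).resolve_left (hm u).ne')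
    · refine Or.inr (sub_eq_zero.1 (norm_eq_zero.1 ?_)).symm
      simpa using h3
  have hB1 : ∀ u, (∑ v, L u v) = 0 ∨ z u = 0 := by
    intro u
    have h1 := (Finset.sum_eq_zero_iff_of_nonneg fun u _ => hb u).1 hB0 u (Finset.mem_univ u)
    rcases mul_eq_zero.1 h1 with h3 | h3
    · left
      have h4 := mul_nonneg (hm u).le (hκ u)
      have h5 : m u * (-∑ v, L u v) = 0 := by linarith [hμ u]
      simpa using (mul_eq_zero.1 h5).resolve_left (hm u).ne'
    · right
      simpa using h3
  refine hz (Matrix.eq_zero_of_mulVec_eq_zero (M := L.map ((↑) : ℝ → ℂ)) ?_ (funext fun u => ?_))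
  · have hdet : L.det ≠ 0 := by
      have h1 := congrArg Matrix.det (hP.neg_mul_potential hlife)
      rw [neg_mul, ← mul_neg, Matrix.det_mul, Matrix.det_one] at h1
      exact left_ne_zero_of_mul_eq_one h1
    have : (L.map ((↑) : ℝ → ℂ)).det = (L.det : ℂ) := (Complex.ofRealHom.map_det L).symm
    rw [this]
    exact_mod_cast hdet
  · have h1 : ((L.map ((↑) : ℝ → ℂ)).mulVec z) u = (∑ v, (L u v : ℂ)) * z u := by
      rw [Matrix.mulVec, dotProduct, Finset.sum_mul]
      refine Finset.sum_congr rfl fun v _ => ?_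
      rw [Matrix.map_apply]
      rcases hA1 u v with h | h <;> simp [h]
    rw [h1, Pi.zero_apply, ← Complex.ofReal_sum]
    rcases hB1 u with h | h <;> simp [h]

end Potential

/-! ### The path measure and its Fourier transform -/

section PathMeasure

variable {X : Type*} [Fintype X] [DecidableEq X] {L : Matrix X X ℝ}
  {P : X → Measure (KilledPath X)}

/-- For fixed `t` the integral over paths produces the factor `(e^{tL})_{xy}`, whose exponential
decay absorbs any power of `t`. The total local time of a path killed at `t` is at most linear in
`t`, so this controls all its moments. -/
theorem IsMarkovFamily.integrable_prod_timeMeasure_pow (hP : IsMarkovFamily L P)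
    (hlife : HasFiniteLifetime P) (x y : X) {a : ℝ} (ha : 0 ≤ a) (k : ℕ) :
    Integrable (fun p : KilledPath X × ℝ≥0 => (1 + a * p.2) ^ k)
      (((P x).prod timeMeasure).restrict {p | p.1 p.2 = some y}) := by
  have := hP.isProbabilityMeasure x
  have : Nonempty X := ⟨x⟩
  have hS := KilledPath.measurableSet_prod_apply_eq (some y)
  have hf : Measurable fun p : KilledPath X × ℝ≥0 => (1 + a * (p.2 : ℝ)) ^ k := by fun_prop
  have hsec : ∀ t : ℝ≥0, (fun w : KilledPath X =>
      {p : KilledPath X × ℝ≥0 | p.1 p.2 = some y}.indicator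
        (fun p => (1 + a * (p.2 : ℝ)) ^ k) (w, t)) =
      {w : KilledPath X | w t = some y}.indicator fun _ => (1 + a * (t : ℝ)) ^ k := fun t => rfl
  rw [← IntegrableOn, ← integrable_indicator_iff hS, integrable_prod_iff'
    (hf.indicator hS).aestronglyMeasurable]
  refine ⟨ae_of_all _ fun t => ?_, ?_⟩
  · rw [hsec, integrable_indicator_iff (KilledPath.measurableSet_apply_eq t _)]
    exact (integrable_const _).integrableOn
  · have hval : (fun t : ℝ≥0 => ∫ w, ‖{p : KilledPath X × ℝ≥0 | p.1 p.2 = some y}.indicator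
        (fun p => (1 + a * (p.2 : ℝ)) ^ k) (w, t)‖ ∂(P x)) =
        fun t : ℝ≥0 => (1 + a * (t : ℝ)) ^ k * NormedSpace.exp ((t : ℝ) • L) x y := by
      funext t
      have : (fun w : KilledPath X => ‖{p : KilledPath X × ℝ≥0 | p.1 p.2 = some y}.indicator
          (fun p => (1 + a * (p.2 : ℝ)) ^ k) (w, t)‖) =
          {w : KilledPath X | w t = some y}.indicator fun _ => (1 + a * (t : ℝ)) ^ k := by
        rw [← hsec t]
        funext w
        refine Real.norm_of_nonneg (Set.indicator_nonneg (fun p _ => ?_) _)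
        positivity
      rw [this, integral_indicator_const _ (KilledPath.measurableSet_apply_eq t _),
        hP.real_apply_eq, smul_eq_mul, mul_comm]
    rw [hval, KilledPath.integrable_timeMeasure_iff]
    · refine (L.integrableOn_pow_mul_exp_smul (hP.tendsto_exp_smul hlife) a k x y).congr_fun
        (fun t ht => ?_) measurableSet_Ioi
      simp only [Real.coe_toNNReal _ (le_of_lt (show (0 : ℝ) < t from ht))]
    · have hc := (L.continuous_exp_smul_apply x y).comp NNReal.continuous_coe
      exact Continuous.stronglyMeasurable (((continuous_const.add
        (continuous_const.mul NNReal.continuous_coe)).pow k).mul hc)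

theorem IsMarkovFamily.isFiniteMeasure_prod_timeMeasure (hP : IsMarkovFamily L P)
    (hlife : HasFiniteLifetime P) (x y : X) :
    IsFiniteMeasure (((P x).prod timeMeasure).restrict {p | p.1 p.2 = some y}) := by
  have h := hP.integrable_prod_timeMeasure_pow hlife x y le_rfl 0
  simp only [pow_zero] at h
  exact (integrable_const_iff_isFiniteMeasure one_ne_zero).1 h

theorem IsMarkovFamily.isFiniteMeasure_pathMeasure (hP : IsMarkovFamily L P)
    (hlife : HasFiniteLifetime P) (m : X → ℝ) (x y : X) :
    IsFiniteMeasure (pathMeasure P m x y) := by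
  have := hP.isFiniteMeasure_prod_timeMeasure hlife x y
  have := Measure.smul_finite (((P x).prod timeMeasure).restrict {p | p.1 p.2 = some y})
    (ENNReal.ofReal_ne_top (r := (m y)⁻¹))
  unfold pathMeasure
  infer_instance

theorem IsMarkovFamily.integrable_pathMeasure_pow (hP : IsMarkovFamily L P)
    (hlife : HasFiniteLifetime P) {m : X → ℝ} (hm : ∀ u, 0 ≤ m u) (x y : X) (k : ℕ) :
    Integrable (fun w => (1 + ∑ u, w.localTime m u) ^ k) (pathMeasure P m x y) := by
  have hmeas : Measurable fun w : KilledPath X => (1 + ∑ u, w.localTime m u) ^ k := by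
    have := KilledPath.measurable_localTime (X := X) m
    fun_prop
  rw [pathMeasure, integrable_map_measure hmeas.aestronglyMeasurable
    KilledPath.measurable_killAt.aemeasurable]
  have ha : 0 ≤ ∑ u, (m u)⁻¹ := Finset.sum_nonneg fun u _ => inv_nonneg.2 (hm u)
  refine Integrable.smul_measure ?_ ENNReal.ofReal_ne_top
  refine (hP.integrable_prod_timeMeasure_pow hlife x y ha k).mono
    (hmeas.comp KilledPath.measurable_killAt).aestronglyMeasurable (ae_of_all _ fun p => ?_)
  have h0 : 0 ≤ ∑ u, (p.1.killAt p.2).localTime m u :=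
    Finset.sum_nonneg fun u _ => KilledPath.localTime_nonneg hm _ u
  simp only [Function.comp_apply, norm_pow]
  rw [Real.norm_of_nonneg (by positivity), Real.norm_of_nonneg (by positivity)]
  gcongr
  exact p.1.sum_localTime_killAt_le hm p.2

/-- The generator `L` perturbed by the imaginary potential `i ξ_u / m_u`. -/
noncomputable def twistedGenerator (L : Matrix X X ℝ) (m ξ : X → ℝ) : Matrix X X ℂ :=
  L.map ((↑) : ℝ → ℂ) + Matrix.diagonal fun u => ((ξ u * (m u)⁻¹ : ℝ) : ℂ) * Complex.I

/-- By Feynman–Kac each entry is the integral of a phase over the event of being at `y`, so its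
modulus is at most `(e^{tL})_{xy}`. -/
theorem IsMarkovFamily.integrableOn_exp_twistedGenerator (hP : IsMarkovFamily L P)
    (hlife : HasFiniteLifetime P) (m ξ : X → ℝ) (x y : X) :
    IntegrableOn (fun t : ℝ => NormedSpace.exp (t • twistedGenerator L m ξ) x y) (Set.Ioi 0) := by
  have := hP.isProbabilityMeasure x
  refine Integrable.mono (hP.integrableOn_exp_smul hlife x y)
    ((twistedGenerator L m ξ).continuous_exp_smul_apply x y).aestronglyMeasurable ?_
  filter_upwards [ae_restrict_mem measurableSet_Ioi] with t ht
  have ht' : (0 : ℝ) < t := ht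
  have hfk := hP.feynmanKac (fun u => ξ u * (m u)⁻¹) x y (Real.toNNReal_pos.2 ht')
  rw [Real.coe_toNNReal _ ht'.le] at hfk
  rw [twistedGenerator, ← hfk, Real.norm_of_nonneg (hP.exp_smul_nonneg ht'.le x y)]
  have hr := hP.real_apply_eq x y t.toNNReal
  rw [Real.coe_toNNReal _ ht'.le] at hr
  refine (norm_setIntegral_le_of_norm_le_const (C := 1) (measure_lt_top _ _)
    fun w _ => (Complex.norm_exp_ofReal_mul_I _).le).trans_eq ?_
  rw [one_mul, hr]

theorem IsMarkovFamily.neg_twistedGenerator_mul (hP : IsMarkovFamily L P)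
    (hlife : HasFiniteLifetime P) (m ξ : X → ℝ) :
    (-twistedGenerator L m ξ) * Matrix.of (fun x y =>
      ∫ t in Set.Ioi (0 : ℝ), NormedSpace.exp (t • twistedGenerator L m ξ) x y) = 1 :=
  Matrix.neg_mul_integral_exp_smul _ (hP.integrableOn_exp_twistedGenerator hlife m ξ)

/-- The Fourier transform of the local time field under the path measure. -/
theorem IsMarkovFamily.integral_pathMeasure_cexp (hP : IsMarkovFamily L P)
    (hlife : HasFiniteLifetime P) {m : X → ℝ} (hm : ∀ u, 0 < m u) (ξ : X → ℝ) (x y : X) :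
    ∫ w, Complex.exp (((∑ u, ξ u * w.localTime m u : ℝ) : ℂ) * Complex.I)
        ∂(pathMeasure P m x y) =
      (∫ t in Set.Ioi (0 : ℝ), NormedSpace.exp (t • twistedGenerator L m ξ) x y) *
        ((m y)⁻¹ : ℝ) := by
  have := hP.isProbabilityMeasure x
  have := hP.isFiniteMeasure_prod_timeMeasure hlife x y
  have hS := KilledPath.measurableSet_prod_apply_eq (some y)
  have hmeas : Measurable fun w : KilledPath X =>
      Complex.exp (((∑ u, ξ u * w.localTime m u : ℝ) : ℂ) * Complex.I) := by
    have := KilledPath.measurable_localTime (X := X) m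
    fun_prop
  have hmeas2 := hmeas.comp KilledPath.measurable_killAt
  have hint : Integrable (fun p : KilledPath X × ℝ≥0 => Complex.exp
      (((∑ u, ξ u * (p.1.killAt p.2).localTime m u : ℝ) : ℂ) * Complex.I))
      (((P x).prod timeMeasure).restrict {p | p.1 p.2 = some y}) :=
    Integrable.of_bound (C := 1) hmeas2.aestronglyMeasurable
      (ae_of_all _ fun p => (Complex.norm_exp_ofReal_mul_I _).le)
  rw [pathMeasure, integral_map KilledPath.measurable_killAt.aemeasurable
    hmeas.aestronglyMeasurable, integral_smul_measure,
    ENNReal.toReal_ofReal (inv_nonneg.2 (hm y).le), Complex.real_smul, mul_comm]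
  congr 1
  -- With the path integrated first, each fixed time gives a Feynman–Kac expression with potential
  -- `ξ/m`.
  rw [← integral_indicator hS, integral_prod_symm _ ((integrable_indicator_iff hS).2 hint)]
  have hsm : StronglyMeasurable fun t : ℝ≥0 => ∫ w,
      {p : KilledPath X × ℝ≥0 | p.1 p.2 = some y}.indicator (fun p => Complex.exp
        (((∑ u, ξ u * (p.1.killAt p.2).localTime m u : ℝ) : ℂ) * Complex.I)) (w, t) ∂(P x) :=
    (hmeas2.indicator hS).stronglyMeasurable.integral_prod_left'
  rw [KilledPath.integral_timeMeasure hsm]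
  refine setIntegral_congr_fun measurableSet_Ioi fun t ht => ?_
  have ht' : (0 : ℝ) < t := ht
  have hfk := hP.feynmanKac (fun u => ξ u * (m u)⁻¹) x y (Real.toNNReal_pos.2 ht')
  rw [Real.coe_toNNReal _ ht'.le] at hfk
  simp only [twistedGenerator]
  rw [← hfk, ← integral_indicator (KilledPath.measurableSet_apply_eq _ _)]
  refine integral_congr_ae (ae_of_all _ fun w => ?_)
  simp only [Set.indicator_apply, Set.mem_ofPred_eq, KilledPath.sum_mul_localTime_killAt,
    Real.coe_toNNReal _ ht'.le]

end PathMeasure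

/-! ### Complex Gaussian weights: integrability and covariance -/

section Gaussian

variable {X : Type*} [Fintype X]

theorem one_add_pow_le_mul_exp {b : ℝ} (hb : 0 < b) (k : ℕ) {s : ℝ} (hs : 0 ≤ s) :
    (1 + s) ^ k ≤ k.factorial / b ^ k * Real.exp b * Real.exp (b * s) := by
  have h := Real.pow_div_factorial_le_exp (b * (1 + s)) (by positivity) k
  rw [mul_pow, mul_add, mul_one, Real.exp_add, div_le_iff₀ (by positivity)] at h
  rw [mul_assoc, div_mul_eq_mul_div, le_div_iff₀ (by positivity)]
  linarith

theorem integrable_exp_neg_mul_sum_sq {b : ℝ} (hb : 0 < b) :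
    Integrable fun z : X → ℂ => Real.exp (-b * ∑ u, ‖z u‖ ^ 2) := by
  have h1 : Integrable fun z : ℂ => Real.exp (-b * ‖z‖ ^ 2) := by
    have h := (GaussianFourier.integrable_cexp_neg_mul_sq_norm_add (V := ℂ) (b := (b : ℂ))
      (by simpa using hb) 0 0).norm
    refine h.congr (ae_of_all _ fun z => ?_)
    simp only [zero_mul, add_zero, Complex.norm_exp]
    congr 1
    rw [← Complex.ofReal_pow, ← Complex.ofReal_neg, ← Complex.ofReal_mul, Complex.ofReal_re]
  have h2 := Integrable.fintype_prod (ι := X) (f := fun _ (z : ℂ) => Real.exp (-b * ‖z‖ ^ 2))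
    fun _ => h1
  refine h2.congr (ae_of_all _ fun z => ?_)
  simp only
  rw [Finset.mul_sum, Real.exp_sum]

/-- Compactness of the unit sphere and homogeneity of degree two. The norm on `X → ℂ` is the
supremum norm, hence the cardinality of `X` in the constant. -/
theorem exists_re_energyForm_le [Nonempty X] {L : Matrix X X ℝ} {m : X → ℝ}
    (h : ∀ z : X → ℂ, z ≠ 0 → (energyForm L m z).re < 0) :
    ∃ c : ℝ, 0 < c ∧ ∀ z : X → ℂ, (energyForm L m z).re ≤ -c * ∑ u, ‖z u‖ ^ 2 := by
  have hcont : Continuous fun z : X → ℂ => (energyForm L m z).re := by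
    unfold energyForm
    fun_prop
  obtain ⟨z₀, hz₀, hmax⟩ := (isCompact_sphere (0 : X → ℂ) 1).exists_isMaxOn
    (NormedSpace.sphere_nonempty.2 zero_le_one) hcont.continuousOn
  have hz₀' : z₀ ≠ 0 := by
    rintro rfl
    simp at hz₀
  have hcard : (0 : ℝ) < Fintype.card X := by exact_mod_cast Fintype.card_pos
  set c₀ := -(energyForm L m z₀).re with hc₀
  have hc₀pos : 0 < c₀ := neg_pos.2 (h z₀ hz₀')
  refine ⟨c₀ / Fintype.card X, by positivity, fun z => ?_⟩
  by_cases hz : z = 0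
  · subst hz
    simp [energyForm]
  have hn : 0 < ‖z‖ := norm_pos_iff.2 hz
  have hhom : (energyForm L m z).re = ‖z‖ ^ 2 * (energyForm L m (‖z‖⁻¹ • z)).re := by
    have : energyForm L m z = ((‖z‖ ^ 2 : ℝ) : ℂ) * energyForm L m (‖z‖⁻¹ • z) := by
      unfold energyForm
      rw [Finset.mul_sum]
      refine Finset.sum_congr rfl fun u _ => ?_
      simp only [Finset.sum_mul, Finset.mul_sum]
      refine Finset.sum_congr rfl fun v _ => ?_
      have hne : (‖z‖ : ℂ) ≠ 0 := by exact_mod_cast hn.ne'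
      simp only [Pi.smul_apply, Complex.real_smul, map_mul, Complex.conj_ofReal]
      push_cast
      field_simp
    rw [this, Complex.re_ofReal_mul]
  have hle : (energyForm L m (‖z‖⁻¹ • z)).re ≤ -c₀ := by
    rw [hc₀, neg_neg]
    refine hmax ?_
    rw [mem_sphere_zero_iff_norm, norm_smul, norm_inv, norm_norm, inv_mul_cancel₀ hn.ne']
  have hsum : ∑ u, ‖z u‖ ^ 2 ≤ Fintype.card X * ‖z‖ ^ 2 := by
    refine (Finset.sum_le_card_nsmul _ _ (‖z‖ ^ 2) fun u _ => ?_).trans_eq ?_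
    · gcongr
      exact norm_le_pi_norm z u
    · rw [nsmul_eq_mul, Finset.card_univ]
  rw [hhom]
  calc ‖z‖ ^ 2 * (energyForm L m (‖z‖⁻¹ • z)).re ≤ ‖z‖ ^ 2 * (-c₀) := by gcongr
    _ = -(c₀ / Fintype.card X) * (Fintype.card X * ‖z‖ ^ 2) := by field_simp
    _ ≤ -(c₀ / Fintype.card X) * ∑ u, ‖z u‖ ^ 2 :=
      mul_le_mul_of_nonpos_left hsum (neg_nonpos.2 (by positivity))

theorem continuous_twistedWeight (L : Matrix X X ℝ) (m : X → ℝ) :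
    Continuous (twistedWeight L m) := by
  unfold twistedWeight energyForm
  fun_prop

theorem norm_twistedWeight (L : Matrix X X ℝ) (m : X → ℝ) (z : X → ℂ) :
    ‖twistedWeight L m z‖ = Real.exp ((energyForm L m z).re / 2) := by
  rw [twistedWeight, Complex.norm_exp]
  congr 1
  have : (1 / 2 : ℂ) = ((1 / 2 : ℝ) : ℂ) := by norm_num
  rw [this, Complex.re_ofReal_mul]
  ring

/-- The twisted Gaussian weight integrates polynomials. -/
theorem integrable_pow_mul_norm_twistedWeight [Nonempty X] {L : Matrix X X ℝ} {m : X → ℝ}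
    (h : ∀ z : X → ℂ, z ≠ 0 → (energyForm L m z).re < 0) (k : ℕ) :
    Integrable fun z : X → ℂ => (1 + ∑ u, ‖z u‖ ^ 2) ^ k * ‖twistedWeight L m z‖ := by
  obtain ⟨c, hc, hle⟩ := exists_re_energyForm_le h
  have hcw := continuous_twistedWeight L m
  refine ((integrable_exp_neg_mul_sum_sq (X := X) (b := c / 4) (by positivity)).const_mul
    (k.factorial / (c / 4) ^ k * Real.exp (c / 4))).mono'
    (Continuous.aestronglyMeasurable (by fun_prop)) (ae_of_all _ fun z => ?_)
  have hs : 0 ≤ ∑ u, ‖z u‖ ^ 2 := by positivity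
  rw [Real.norm_of_nonneg (by positivity), norm_twistedWeight]
  calc (1 + ∑ u, ‖z u‖ ^ 2) ^ k * Real.exp ((energyForm L m z).re / 2)
      ≤ (k.factorial / (c / 4) ^ k * Real.exp (c / 4) * Real.exp (c / 4 * ∑ u, ‖z u‖ ^ 2)) *
        Real.exp (-c * (∑ u, ‖z u‖ ^ 2) / 2) := by
        gcongr
        · exact one_add_pow_le_mul_exp (by positivity) k hs
        · exact hle z
    _ = _ := by
        rw [mul_assoc, ← Real.exp_add]
        congr 2
        ring

/-- The sesquilinear form `∑ (N z)_u z̄_u` of a matrix. -/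
noncomputable def matrixForm (N : Matrix X X ℂ) (z : X → ℂ) : ℂ :=
  ∑ u, (∑ v, N u v * z v) * (starRingEnd ℂ) (z u)

theorem continuous_matrixForm (N : Matrix X X ℂ) : Continuous (matrixForm N) := by
  unfold matrixForm
  fun_prop

theorem hasDerivAt_matrixForm_line [DecidableEq X] (N : Matrix X X ℂ) (z : X → ℂ) (w : X)
    (α : ℂ) : HasDerivAt (fun t : ℝ => matrixForm N (z + t • (Pi.single w α : X → ℂ)))
      ((starRingEnd ℂ) α * (∑ v, N w v * z v) + α * ∑ u, N u w * (starRingEnd ℂ) (z u)) 0 := by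
  have hc : ∀ u, HasDerivAt (fun t : ℝ => (z + t • (Pi.single w α : X → ℂ)) u)
      ((Pi.single w α : X → ℂ) u) 0 := by
    intro u
    have := ((hasDerivAt_id (0 : ℝ)).smul_const ((Pi.single w α : X → ℂ) u)).const_add (z u)
    simpa using this
  have hcc : ∀ u, HasDerivAt (fun t : ℝ => (starRingEnd ℂ) ((z + t • (Pi.single w α : X → ℂ)) u))
      ((starRingEnd ℂ) ((Pi.single w α : X → ℂ) u)) 0 := fun u =>
    (Complex.conjCLE : ℂ →L[ℝ] ℂ).hasFDerivAt.comp_hasDerivAt 0 (hc u)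
  have h := HasDerivAt.fun_sum fun u (_ : u ∈ (Finset.univ : Finset X)) =>
    (HasDerivAt.fun_sum fun v (_ : v ∈ (Finset.univ : Finset X)) =>
      (hc v).const_mul (N u v)).mul (hcc u)
  refine h.congr_deriv ?_
  simp only [zero_smul, add_zero, Finset.sum_add_distrib, Pi.single_apply, mul_ite, mul_zero,
    Finset.sum_ite_eq', Finset.mem_univ, if_true, apply_ite (starRingEnd ℂ), map_zero]
  rw [add_comm, Finset.mul_sum (a := α), mul_comm]
  congr 1
  exact Finset.sum_congr rfl fun u _ => by ring

theorem norm_le_one_add_sum_sq (z : X → ℂ) (y : X) : ‖z y‖ ≤ 1 + ∑ u, ‖z u‖ ^ 2 := by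
  have h : ‖z y‖ ^ 2 ≤ ∑ u, ‖z u‖ ^ 2 :=
    Finset.single_le_sum (f := fun u => ‖z u‖ ^ 2) (fun _ _ => by positivity) (Finset.mem_univ y)
  nlinarith [sq_nonneg (‖z y‖ - 1)]

theorem norm_mul_norm_le_one_add_sum_sq (z : X → ℂ) (x y : X) :
    ‖z x‖ * ‖z y‖ ≤ 1 + ∑ u, ‖z u‖ ^ 2 := by
  have h : ∀ y, ‖z y‖ ^ 2 ≤ ∑ u, ‖z u‖ ^ 2 := fun y =>
    Finset.single_le_sum (f := fun u => ‖z u‖ ^ 2) (fun _ _ => by positivity) (Finset.mem_univ y)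
  nlinarith [sq_nonneg (‖z x‖ - ‖z y‖), h x, h y]

/-- The covariance of a complex Gaussian weight is the inverse of its matrix. -/
theorem neg_sum_mul_integral_eq [DecidableEq X] (N : Matrix X X ℂ)
    (hN : Integrable fun z : X → ℂ =>
      (1 + ∑ u, ‖z u‖ ^ 2) * ‖Complex.exp ((1 / 2 : ℂ) * matrixForm N z)‖) (w y : X) :
    ∑ v, -N w v * ∫ z : X → ℂ, (1 / 2 : ℂ) * (z v * (starRingEnd ℂ) (z y)) *
        Complex.exp ((1 / 2 : ℂ) * matrixForm N z) =
      (if w = y then 1 else 0) * ∫ z : X → ℂ, Complex.exp ((1 / 2 : ℂ) * matrixForm N z) := by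
  set g : (X → ℂ) → ℂ := fun z => Complex.exp ((1 / 2 : ℂ) * matrixForm N z) with hg
  have hgc : Continuous g := by
    have := continuous_matrixForm N
    fun_prop
  have hint : ∀ f : (X → ℂ) → ℂ, Continuous f → (∀ z, ‖f z‖ ≤ 1 + ∑ u, ‖z u‖ ^ 2) →
      Integrable fun z => f z * g z := by
    intro f hf hb
    refine hN.mono' (Continuous.aestronglyMeasurable (by fun_prop)) (ae_of_all _ fun z => ?_)
    rw [norm_mul]
    gcongr
    exact hb z
  have h0 : Integrable fun z => g z := by
    simpa using hint (fun _ => 1) continuous_const fun z => by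
      simpa using (by positivity : 0 ≤ ∑ u, ‖z u‖ ^ 2)
  have h1 : Integrable fun z => (starRingEnd ℂ) (z y) * g z :=
    hint _ (by fun_prop) fun z => by simpa using norm_le_one_add_sum_sq z y
  have h2 : ∀ v, Integrable fun z : X → ℂ => z v * (starRingEnd ℂ) (z y) * g z := fun v =>
    hint _ (by fun_prop) fun z => by simpa using norm_mul_norm_le_one_add_sum_sq z v y
  have h3 : ∀ v, Integrable fun z : X → ℂ => (starRingEnd ℂ) (z v) * (starRingEnd ℂ) (z y) * g z :=
    fun v => hint _ (by fun_prop) fun z => by simpa using norm_mul_norm_le_one_add_sum_sq z v y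
  set J₁ := ∑ v, N w v * ∫ z : X → ℂ, z v * (starRingEnd ℂ) (z y) * g z with hJ₁
  set J₂ := ∑ v, N v w * ∫ z : X → ℂ, (starRingEnd ℂ) (z v) * (starRingEnd ℂ) (z y) * g z with hJ₂
  set Z := (if w = y then 1 else 0) * ∫ z, g z with hZ
  -- Integration by parts against `z̄_y` in the real direction `α e_w`. The values `α = 1` and `α =
  -- i` combine into the Wirtinger derivative in `z̄_w`, which eliminates `J₂` and isolates `J₁`.
  have ibp : ∀ α : ℂ, (1 / 2 : ℂ) * ((starRingEnd ℂ) α * J₁ + α * J₂) =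
      -((starRingEnd ℂ) α * Z) := by
    intro α
    set dg : (X → ℂ) → ℂ := fun z => g z * ((1 / 2 : ℂ) * ((starRingEnd ℂ) α *
      (∑ v, N w v * z v) + α * ∑ u, N u w * (starRingEnd ℂ) (z u))) with hdg
    have hexp : ∀ z, (starRingEnd ℂ) (z y) * dg z = (1 / 2 : ℂ) *
        ((starRingEnd ℂ) α * (∑ v, N w v * (z v * (starRingEnd ℂ) (z y) * g z)) +
        α * ∑ v, N v w * ((starRingEnd ℂ) (z v) * (starRingEnd ℂ) (z y) * g z)) := by
      intro z
      have e1 : ∑ v, N w v * (z v * (starRingEnd ℂ) (z y) * g z) =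
          (∑ v, N w v * z v) * ((starRingEnd ℂ) (z y) * g z) := by
        rw [Finset.sum_mul]
        exact Finset.sum_congr rfl fun v _ => by ring
      have e2 : ∑ v, N v w * ((starRingEnd ℂ) (z v) * (starRingEnd ℂ) (z y) * g z) =
          (∑ v, N v w * (starRingEnd ℂ) (z v)) * ((starRingEnd ℂ) (z y) * g z) := by
        rw [Finset.sum_mul]
        exact Finset.sum_congr rfl fun v _ => by ring
      rw [e1, e2, hdg]
      ring
    have i1 : Integrable fun z : X → ℂ => ∑ v, N w v * (z v * (starRingEnd ℂ) (z y) * g z) :=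
      integrable_finsetSum _ fun v _ => (h2 v).const_mul _
    have i2 : Integrable fun z : X → ℂ =>
        ∑ v, N v w * ((starRingEnd ℂ) (z v) * (starRingEnd ℂ) (z y) * g z) :=
      integrable_finsetSum _ fun v _ => (h3 v).const_mul _
    have idg : Integrable fun z : X → ℂ => (starRingEnd ℂ) (z y) * dg z := by
      simp_rw [hexp]
      exact ((i1.const_mul _).add (i2.const_mul _)).const_mul _
    have key := integral_bilinear_hasLineDerivAt_right_eq_neg_left_of_integrable
      (μ := (volume : Measure (X → ℂ))) (f := fun z : X → ℂ => (starRingEnd ℂ) (z y))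
      (f' := fun _ => (starRingEnd ℂ) ((Pi.single w α : X → ℂ) y)) (g := g) (g' := dg)
      (v := Pi.single w α) (B := ContinuousLinearMap.mul ℝ ℂ)
      (by simpa using h0.const_mul ((starRingEnd ℂ) ((Pi.single w α : X → ℂ) y)))
      (by simpa using idg) (by simpa using h1) (fun z _ => by
        have hc : HasDerivAt (fun t : ℝ => (z + t • (Pi.single w α : X → ℂ)) y)
            ((Pi.single w α : X → ℂ) y) 0 := by
          have := ((hasDerivAt_id (0 : ℝ)).smul_const ((Pi.single w α : X → ℂ) y)).const_add (z y)
          simpa using this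
        exact (Complex.conjCLE : ℂ →L[ℝ] ℂ).hasFDerivAt.comp_hasDerivAt 0 hc) (fun z _ => by
        have := ((hasDerivAt_matrixForm_line N z w α).const_mul (1 / 2 : ℂ)).cexp
        simpa [HasLineDerivAt, hg, hdg] using this)
    simp only [ContinuousLinearMap.mul_apply'] at key
    simp_rw [hexp] at key
    rw [integral_const_mul, integral_add (i1.const_mul _) (i2.const_mul _), integral_const_mul,
      integral_const_mul, integral_finsetSum _ fun v _ => (h2 v).const_mul _,
      integral_finsetSum _ fun v _ => (h3 v).const_mul _, integral_const_mul] at key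
    simp_rw [integral_const_mul] at key
    rw [key, hZ]
    by_cases hwy : w = y
    · subst hwy; simp
    · simp [hwy]
  have a1 := ibp 1
  have a2 := ibp Complex.I
  rw [map_one] at a1
  rw [Complex.conj_I] at a2
  have hfin : (1 / 2 : ℂ) * J₁ = -Z := by
    have a3 : (1 / 2 : ℂ) * (J₂ - J₁) = Z := by
      refine mul_left_cancel₀ Complex.I_ne_zero ?_
      linear_combination a2
    linear_combination (a1 - a3) / 2
  have hsum : ∑ v, -N w v * ∫ z : X → ℂ, (1 / 2 : ℂ) * (z v * (starRingEnd ℂ) (z y)) * g z =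
      -((1 / 2 : ℂ) * J₁) := by
    rw [hJ₁, Finset.mul_sum, ← Finset.sum_neg_distrib]
    refine Finset.sum_congr rfl fun v _ => ?_
    simp_rw [mul_assoc (1 / 2 : ℂ)]
    rw [integral_const_mul]
    ring
  rw [hsum, hfin, neg_neg]

end Gaussian

/-! ### Comparison of the Fourier transforms and the isomorphism formula -/

section Isomorphism

variable {X : Type*}

theorem continuous_halfSquare : Continuous (halfSquare : (X → ℂ) → X → ℝ) := by
  unfold halfSquare
  fun_prop

theorem halfSquare_nonneg (z : X → ℂ) (u : X) : 0 ≤ halfSquare z u := by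
  unfold halfSquare
  positivity

theorem halfSquare_le (z : X → ℂ) (u : X) : halfSquare z u ≤ ‖z u‖ ^ 2 := by
  unfold halfSquare
  linarith [sq_nonneg ‖z u‖]

variable [Fintype X] [DecidableEq X] {L : Matrix X X ℝ}
  {P : X → Measure (KilledPath X)}

/-- The factor `m` of the energy form cancels the `1/m` of the imaginary potential, so the character
of the field becomes a perturbation of the generator. -/
theorem half_mul_matrixForm_twistedGenerator {m : X → ℝ} (hm : ∀ u, m u ≠ 0) (ξ : X → ℝ)
    (z : X → ℂ) :
    (1 / 2 : ℂ) * matrixForm (Matrix.of fun u v => (m u : ℂ) * twistedGenerator L m ξ u v) z =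
      ((∑ u, ξ u * halfSquare z u : ℝ) : ℂ) * Complex.I + (1 / 2 : ℂ) * energyForm L m z := by
  rw [matrixForm, energyForm, Complex.ofReal_sum, Finset.sum_mul, Finset.mul_sum, Finset.mul_sum,
    ← Finset.sum_add_distrib]
  refine Finset.sum_congr rfl fun u _ => ?_
  have hmu : (m u : ℂ) ≠ 0 := by exact_mod_cast hm u
  have h1 : ∑ v, (Matrix.of fun u v => (m u : ℂ) * twistedGenerator L m ξ u v) u v * z v =
      m u * (∑ v, (L u v : ℂ) * z v) + ξ u * Complex.I * z u := by
    simp only [Matrix.of_apply, twistedGenerator, Matrix.add_apply, Matrix.map_apply, mul_add,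
      add_mul, Finset.sum_add_distrib]
    congr 1
    · rw [Finset.mul_sum]
      exact Finset.sum_congr rfl fun v _ => by ring
    · rw [Finset.sum_eq_single u]
      · rw [Matrix.diagonal_apply_eq]
        push_cast
        field_simp
      · intro v _ hv
        rw [Matrix.diagonal_apply_ne _ hv.symm]
        ring
      · simp
  have h2 : ((halfSquare z u : ℝ) : ℂ) = z u * (starRingEnd ℂ) (z u) / 2 := by
    rw [halfSquare, Complex.mul_conj, Complex.normSq_eq_norm_sq]
    push_cast
    rfl
  rw [h1, Complex.ofReal_mul, h2]
  ring

theorem IsMarkovFamily.integral_fourier_eq (hP : IsMarkovFamily L P)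
    (hlife : HasFiniteLifetime P) {m : X → ℝ} (hm : ∀ u, 0 < m u)
    (hneg : ∀ z : X → ℂ, z ≠ 0 → (energyForm L m z).re < 0) (x y : X) (ξ : X → ℝ) :
    ∫ z : X → ℂ, Complex.exp (((∑ u, ξ u * halfSquare z u : ℝ) : ℂ) * Complex.I) *
        ((1 / 2 : ℂ) * (z x * (starRingEnd ℂ) (z y)) * twistedWeight L m z) =
      ∫ p : (X → ℂ) × KilledPath X, Complex.exp
        (((∑ u, ξ u * (p.2.localTime m + halfSquare p.1) u : ℝ) : ℂ) * Complex.I) *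
        twistedWeight L m p.1 ∂((volume : Measure (X → ℂ)).prod (pathMeasure P m x y)) := by
  have : Nonempty X := ⟨x⟩
  have := hP.isFiniteMeasure_pathMeasure hlife m x y
  set N : Matrix X X ℂ := Matrix.of fun u v => (m u : ℂ) * twistedGenerator L m ξ u v with hN
  set G : Matrix X X ℂ := Matrix.of fun x y =>
    ∫ t in Set.Ioi (0 : ℝ), NormedSpace.exp (t • twistedGenerator L m ξ) x y with hG
  set A : Matrix X X ℂ := Matrix.of fun v y => ∫ z : X → ℂ, (1 / 2 : ℂ) *
    (z v * (starRingEnd ℂ) (z y)) * Complex.exp ((1 / 2 : ℂ) * matrixForm N z) with hA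
  set Z : ℂ := ∫ z : X → ℂ, Complex.exp ((1 / 2 : ℂ) * matrixForm N z) with hZ
  have hexp : ∀ z : X → ℂ, Complex.exp ((1 / 2 : ℂ) * matrixForm N z) =
      Complex.exp (((∑ u, ξ u * halfSquare z u : ℝ) : ℂ) * Complex.I) * twistedWeight L m z := by
    intro z
    rw [hN, half_mul_matrixForm_twistedGenerator (fun u => (hm u).ne'), Complex.exp_add,
      twistedWeight]
  have hcov : (-twistedGenerator L m ξ) * A = Matrix.diagonal fun u => ((m u : ℂ))⁻¹ * Z := by
    ext w v
    have h := neg_sum_mul_integral_eq N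
      ((integrable_pow_mul_norm_twistedWeight hneg 1).congr (ae_of_all _ fun z => by
        simp only [hexp, norm_mul, Complex.norm_exp_ofReal_mul_I, one_mul, pow_one])) w v
    have hmw : (m w : ℂ) ≠ 0 := by exact_mod_cast (hm w).ne'
    rw [Matrix.diagonal_apply, Matrix.mul_apply]
    refine mul_left_cancel₀ hmw ?_
    have h' : (m w : ℂ) * ∑ j, (-twistedGenerator L m ξ) w j * A j v =
        ∑ j, -N w j * A j v := by
      rw [Finset.mul_sum]
      refine Finset.sum_congr rfl fun j _ => ?_
      rw [hN, Matrix.of_apply, Matrix.neg_apply]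
      ring
    rw [h']
    refine h.trans ?_
    split_ifs
    · rw [one_mul, mul_inv_cancel_left₀ hmw]
    · simp
  -- The covariance and the integrated twisted semigroup come from inverting the same matrix `-L_ξ`.
  -- This is the whole coincidence behind the formula.
  have hGA : A = G * Matrix.diagonal fun u => ((m u : ℂ))⁻¹ * Z := by
    have h1 : G * (-twistedGenerator L m ξ) = 1 :=
      mul_eq_one_comm.1 (hP.neg_twistedGenerator_mul hlife m ξ)
    rw [← hcov, ← mul_assoc, h1, one_mul]
  have hleft : ∫ z : X → ℂ, Complex.exp (((∑ u, ξ u * halfSquare z u : ℝ) : ℂ) * Complex.I) *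
      ((1 / 2 : ℂ) * (z x * (starRingEnd ℂ) (z y)) * twistedWeight L m z) = A x y := by
    rw [hA, Matrix.of_apply]
    refine integral_congr_ae (ae_of_all _ fun z => ?_)
    simp only [hexp]
    ring
  have hright : (fun p : (X → ℂ) × KilledPath X => Complex.exp
      (((∑ u, ξ u * (p.2.localTime m + halfSquare p.1) u : ℝ) : ℂ) * Complex.I) *
      twistedWeight L m p.1) = fun p => Complex.exp ((1 / 2 : ℂ) * matrixForm N p.1) *
      Complex.exp (((∑ u, ξ u * p.2.localTime m u : ℝ) : ℂ) * Complex.I) := by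
    funext p
    simp only [hexp, Pi.add_apply, mul_add, Finset.sum_add_distrib, Complex.ofReal_add, add_mul,
      Complex.exp_add]
    ring
  rw [hleft, hright, integral_prod_mul (fun z : X → ℂ =>
    Complex.exp ((1 / 2 : ℂ) * matrixForm N z)) (fun w : KilledPath X =>
    Complex.exp (((∑ u, ξ u * w.localTime m u : ℝ) : ℂ) * Complex.I)),
    hP.integral_pathMeasure_cexp hlife hm, hGA, Matrix.mul_diagonal]
  rw [hG, Matrix.of_apply]
  push_cast
  ring

end Isomorphism

theorem proposition1 {X : Type*} [Fintype X] [DecidableEq X]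
    (L : Matrix X X ℝ) (P : X → Measure (KilledPath X))
    (hP : IsMarkovFamily L P) (hirr : IsIrreducibleFamily P) (hlife : HasFiniteLifetime P)
    (μ : X → ℝ) (hμ : ∀ u, 0 ≤ μ u) (hμ_sum : ∑ u, μ u = 1) (x y : X)
    (F : (X → ℝ) → ℂ) (hF : ContinuousOn F {ρ | ∀ u, 0 ≤ ρ u}) :
    -- the formula, whenever both sides converge absolutely
    (Integrable (gaussianSide L (refMeasure L μ) F x y) volume →
      Integrable (localTimeSide L (refMeasure L μ) F)
        ((volume : Measure (X → ℂ)).prod (pathMeasure P (refMeasure L μ) x y)) →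
      ∫ z : X → ℂ, (1 / 2 : ℂ) * (z x * (starRingEnd ℂ) (z y)) * F (halfSquare z) *
          twistedWeight L (refMeasure L μ) z =
        ∫ z : X → ℂ,
          (∫ w, F (w.localTime (refMeasure L μ) + halfSquare z)
            ∂(pathMeasure P (refMeasure L μ) x y)) *
          twistedWeight L (refMeasure L μ) z) ∧
    -- both sides do converge absolutely when `F` has at most polynomial growth
    ((∃ (C : ℝ) (k : ℕ), ∀ ρ : X → ℝ, (∀ u, 0 ≤ ρ u) → ‖F ρ‖ ≤ C * (1 + ∑ u, ρ u) ^ k) →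
      Integrable (gaussianSide L (refMeasure L μ) F x y) volume ∧
      Integrable (localTimeSide L (refMeasure L μ) F)
        ((volume : Measure (X → ℂ)).prod (pathMeasure P (refMeasure L μ) x y))) := by
  classical
  have : Nonempty X := ⟨x⟩
  have hm := hP.refMeasure_pos hirr hlife hμ hμ_sum
  have hneg : ∀ z : X → ℂ, z ≠ 0 → (energyForm L (refMeasure L μ) z).re < 0 :=
    fun z hz => hP.re_energyForm_neg hirr hlife hμ hμ_sum hz
  set m := refMeasure L μ with hm_def
  have := hP.isFiniteMeasure_pathMeasure hlife m x y
  have hW := continuous_twistedWeight L m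
  set O : Set (X → ℝ) := {ρ | ∀ u, 0 ≤ ρ u} with hO
  have hOm : MeasurableSet O := by
    rw [hO, Set.ofPred_forall]
    exact MeasurableSet.iInter fun u => measurableSet_le measurable_const (measurable_pi_apply u)
  -- `F` is controlled on the orthant only. Extension by zero makes it measurable everywhere and
  -- changes neither side, since both fields take values in the orthant.
  set H : (X → ℝ) → ℂ := O.piecewise F fun _ => 0 with hH
  have hHm : Measurable H := hF.measurable_piecewise continuousOn_const hOm
  have hHF : ∀ ρ ∈ O, H ρ = F ρ := fun ρ hρ => Set.piecewise_eq_of_mem _ _ _ hρ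
  have hT₁ : Measurable (halfSquare : (X → ℂ) → X → ℝ) := continuous_halfSquare.measurable
  have hT₂ : Measurable fun p : (X → ℂ) × KilledPath X => p.2.localTime m + halfSquare p.1 :=
    ((KilledPath.measurable_localTime m).comp measurable_snd).add (hT₁.comp measurable_fst)
  have hO₁ : ∀ z : X → ℂ, halfSquare z ∈ O := halfSquare_nonneg
  have hO₂ : ∀ p : (X → ℂ) × KilledPath X, p.2.localTime m + halfSquare p.1 ∈ O := fun p u =>
    add_nonneg (KilledPath.localTime_nonneg (fun u => (hm u).le) _ u) (halfSquare_nonneg _ u)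
  set g₁ : (X → ℂ) → ℂ := fun z =>
    (1 / 2 : ℂ) * (z x * (starRingEnd ℂ) (z y)) * twistedWeight L m z with hg₁
  set g₂ : (X → ℂ) × KilledPath X → ℂ := fun p => twistedWeight L m p.1 with hg₂
  have hgm₁ : Measurable g₁ := by
    have : Continuous g₁ := by fun_prop
    exact this.measurable
  have hgm₂ : Measurable g₂ := hW.measurable.comp measurable_fst
  have side₁ : gaussianSide L m F x y = fun z => H (halfSquare z) * g₁ z := by
    funext z
    rw [hHF _ (hO₁ z), gaussianSide, hg₁]
    ring
  have side₂ : localTimeSide L m F =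
      fun p => H (p.2.localTime m + halfSquare p.1) * g₂ p := by
    funext p
    rw [hHF _ (hO₂ p), localTimeSide]
  have hgb₁ : ∀ z, ‖g₁ z‖ ≤ (1 + ∑ u, ‖z u‖ ^ 2) * ‖twistedWeight L m z‖ := by
    intro z
    rw [hg₁, norm_mul]
    gcongr
    have h1 := norm_mul_norm_le_one_add_sum_sq z x y
    have h2 : 0 ≤ ‖z x‖ * ‖z y‖ := by positivity
    simp only [norm_mul, norm_div, norm_one, RCLike.norm_ofNat, RCLike.norm_conj]
    linarith
  have hgi₁ : Integrable g₁ := by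
    refine (integrable_pow_mul_norm_twistedWeight hneg 1).mono' hgm₁.aestronglyMeasurable
      (ae_of_all _ fun z => ?_)
    simpa using hgb₁ z
  have hgi₂ : Integrable g₂ ((volume : Measure (X → ℂ)).prod (pathMeasure P m x y)) := by
    have h := integrable_pow_mul_norm_twistedWeight hneg 0
    simp only [pow_zero, one_mul] at h
    exact ((integrable_norm_iff hW.aestronglyMeasurable).1 h).comp_fst _
  refine ⟨fun hi₁ hi₂ => ?_, fun ⟨C, k, hC⟩ => ⟨?_, ?_⟩⟩
  · have hright : ∫ z : X → ℂ, (∫ w, F (w.localTime m + halfSquare z) ∂(pathMeasure P m x y)) *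
        twistedWeight L m z = ∫ p, localTimeSide L m F p
          ∂((volume : Measure (X → ℂ)).prod (pathMeasure P m x y)) := by
      rw [integral_prod _ hi₂]
      refine integral_congr_ae (ae_of_all _ fun z => ?_)
      simp only [localTimeSide]
      rw [integral_mul_const]
    rw [hright]
    change ∫ z, gaussianSide L m F x y z = _
    rw [side₁] at hi₁ ⊢
    rw [side₂] at hi₂ ⊢
    exact integral_comp_mul_eq_of_fourier_eq hT₁ hT₂ hgm₁ hgm₂ hgi₁ hgi₂
      (fun ξ => hP.integral_fourier_eq hlife hm hneg x y ξ) hHm hi₁ hi₂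
  · rw [side₁]
    -- The extra power pays for the factor `z_x z̄_y`.
    refine ((integrable_pow_mul_norm_twistedWeight hneg (k + 1)).const_mul |C|).mono'
      ((hHm.comp hT₁).mul hgm₁).aestronglyMeasurable (ae_of_all _ fun z => ?_)
    have h0 : 0 ≤ ∑ u, halfSquare z u := Finset.sum_nonneg fun u _ => halfSquare_nonneg z u
    rw [norm_mul, hHF _ (hO₁ z)]
    calc ‖F (halfSquare z)‖ * ‖g₁ z‖
        ≤ (|C| * (1 + ∑ u, ‖z u‖ ^ 2) ^ k) *
          ((1 + ∑ u, ‖z u‖ ^ 2) * ‖twistedWeight L m z‖) := by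
          gcongr
          · refine (hC _ (hO₁ z)).trans ?_
            gcongr
            · exact le_abs_self C
            · exact halfSquare_le z _
          · exact hgb₁ z
      _ = _ := by ring
  · rw [side₂]
    -- The inequality `1 + a + b ≤ (1 + a)(1 + b)` for nonnegative `a`, `b` separates the field from
    -- the path, so a product of integrable functions dominates.
    have hprod := ((integrable_pow_mul_norm_twistedWeight hneg k).const_mul |C|).mul_prod
      (hP.integrable_pathMeasure_pow hlife (fun u => (hm u).le) x y k)
    refine hprod.mono' ((hHm.comp hT₂).mul hgm₂).aestronglyMeasurable (ae_of_all _ fun p => ?_)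
    have h0 : 0 ≤ ∑ u, halfSquare p.1 u := Finset.sum_nonneg fun u _ => halfSquare_nonneg _ u
    have h1 : 0 ≤ ∑ u, p.2.localTime m u := Finset.sum_nonneg fun u _ =>
      KilledPath.localTime_nonneg (fun u => (hm u).le) _ u
    have h2 : ∑ u, halfSquare p.1 u ≤ ∑ u, ‖p.1 u‖ ^ 2 :=
      Finset.sum_le_sum fun u _ => halfSquare_le p.1 u
    rw [norm_mul, hHF _ (hO₂ p)]
    calc ‖F (p.2.localTime m + halfSquare p.1)‖ * ‖g₂ p‖
        ≤ (|C| * ((1 + ∑ u, ‖p.1 u‖ ^ 2) * (1 + ∑ u, p.2.localTime m u)) ^ k) * ‖g₂ p‖ := by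
          gcongr
          refine (hC _ (hO₂ p)).trans ?_
          simp only [Pi.add_apply, Finset.sum_add_distrib]
          gcongr
          · exact le_abs_self C
          · nlinarith [mul_nonneg (h0.trans h2) h1]
      _ = _ := by rw [mul_pow]; ring
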